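/- Let $d\ge 2$, let $\mathbb{S}^d\subset\mathbb{R}^{d+1}$ be the unit sphere with its (unnormalized) surface measure, and let $\mathbb{K}\in\{\mathbb{C},\mathbb{R}\}$. For $k\in\mathbb{N}$ let $E^k_{\mathbb K}\subset L^2(\mathbb{S}^d;\mathbb{K})$ be the space of spherical harmonics of degree $k$ (restrictions to $\mathbb{S}^d$ of homogeneous harmonic polynomials of degree $k$ with coefficients in $\mathbb{K}$), and let $N_k=\dim_{\mathbb K}E^k_{\mathbb K}$, which is the same number for $\mathbb{K}=\mathbb{R}$ and $\mathbb{K}=\mathbb{C}$. Fixing an arbitrary orthonormal basis of each $E^k_{\mathbb K}$, identify the set of orthonormal bases of $E^k_{\mathbb K}$ with $U(N_k)$ if $\mathbb{K}=\mathbb{C}$ and with $O(N_k)$ if $\mathbb{K}=\mathbb{R}$, and hence the Hilbert bases $B=(b_{k,l})_{k\in\mathbb{N},\,1\le l\le N_k}$ of $L^2(\mathbb{S}^d;\mathbb{K})$ made of spherical harmonics with $\mathcal{B}=\prod_k U(N_k)$, resp. $\tilde{\mathcal B}=\prod_k O(N_k)$. Let $\nu$, resp. $\tilde\nu$, be the product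 of the Haar probability measures. For $2\le q<\infty$, let $\mathcal{M}_{q,k}$, resp. $\tilde{\mathcal M}_{q,k}$, denote the median of $u\mapsto\|u\|_{L^q(\mathbb{S}^d)}$ on the unit sphere of $E^k_{\mathbb C}$, resp. $E^k_{\mathbb R}$, with its uniform probability $P$, that is, a number $m$ with $P(\|u\|_{L^q}\ge m)\ge\frac12$ and $P(\|u\|_{L^q}\le m)\ge\frac12$; such a number exists, and the statements below hold for any such number. Then: (1) There is $c>0$ and, for every $2\le q<\infty$, a constant $C_q>0$ such that for all $r\ge 0$ $$\nu\big(\{B\in\mathcal{B}:\ \exists k,l,\ \big|\|b_{k,l}\|_{L^q(\mathbb{S}^d)}-\mathcal{M}_{q,k}\big|>r\}\big)\le C_q e^{-cr^2},$$ $$\tilde\nu\big(\{B\in\tilde{\mathcal B}:\ \exists k,l,\ \big|\|b_{k,l}\|_{L^q(\mathbb{S}^d)}-\tilde{\mathcal M}_{q,k}\big|>r\}\big)\le C_q e^{-cr^2}.$$ (2) (Complex case.) There is a constant $C$, independent of $q$ and $k$, such that for all $2\le q<\infty$ and $k\in\mathbb{N}$ $$|\mathcal{A}_{q,k}-\mathcal{M}_{q,k}|\le\frac{C}{N_k^{1/q}}\sqrt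 q,\qquad \mathcal{A}_{q,k}=\frac{N_k^{1/2}}{\mathrm{Vol}(\mathbb{S}^d)^{\frac12-\frac1q}}\left(q\,\frac{\Gamma(q/2)\,\Gamma(N_k)}{2\,\Gamma(q/2+N_k)}\right)^{1/q}.$$ (3) For $\nu$-almost every $B\in\mathcal{B}$, resp. $\tilde\nu$-almost every $B\in\tilde{\mathcal B}$: for every $1\le q<\infty$, $\sup_{k,l}\|b_{k,l}\|_{L^q(\mathbb{S}^d)}<\infty$. -/

import Mathlib

open MeasureTheory
open scoped ENNReal NNReal

noncomputable section

namespace SphHarm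

/-! ### Haar probability on the unitary (orthogonal) group -/

section Unitary

variable (n : ℕ) (𝕂 : Type) [RCLike 𝕂]

/-- `U(n)` for `𝕂 = ℂ`, and `O(n)` for `𝕂 = ℝ`. -/
abbrev UGroup : Type := Matrix.unitaryGroup (Fin n) 𝕂

instance : MeasurableSpace (UGroup n 𝕂) := borel _

instance : BorelSpace (UGroup n 𝕂) := ⟨rfl⟩

instance : CompactSpace (UGroup n 𝕂) := by
  rw [← isCompact_univ_iff, Subtype.isCompact_iff, Set.image_univ, Subtype.range_coe_subtype]
  have hK : IsCompact (Set.pi Set.univ fun _ : Fin n => Set.pi Set.univ fun _ : Fin n =>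
      Metric.closedBall (0 : 𝕂) 1) :=
    isCompact_univ_pi fun _ => isCompact_univ_pi fun _ => isCompact_closedBall 0 1
  have hK' : IsCompact {A : Matrix (Fin n) (Fin n) 𝕂 | ∀ i j, ‖A i j‖ ≤ 1} := by
    convert! hK using 1
    ext A
    exact ⟨fun h i _ j _ => by simpa using h i j,
      fun h i j => by simpa using h i trivial j trivial⟩
  refine hK'.of_isClosed_subset (isClosed_unitary (R := Matrix (Fin n) (Fin n) 𝕂)) ?_
  intro A hA i j
  exact entry_norm_bound_of_unitary hA i j

/-- The Haar measure of total mass `1`. -/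
def haarU : Measure (UGroup n 𝕂) := Measure.haarMeasure ⊤

instance : IsProbabilityMeasure (haarU n 𝕂) :=
  ⟨by simpa [haarU] using
    Measure.haarMeasure_self (K₀ := (⊤ : TopologicalSpace.PositiveCompacts (UGroup n 𝕂)))⟩

end Unitary

/-! ### The uniform probability on the unit sphere, and medians -/

/-- The uniform probability on the unit sphere of a finite dimensional Euclidean space: the
normalized cone measure of Lebesgue measure (the normalization of Lebesgue measure is
irrelevant). -/
def uniformSphere (E : Type) [NormedAddCommGroup E] [NormedSpace ℝ E] [FiniteDimensional ℝ E]
    [MeasurableSpace E] [BorelSpace E] : Measure (Metric.sphere (0 : E) 1) :=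
  ((Measure.addHaar : Measure E).toSphere Set.univ)⁻¹ • (Measure.addHaar : Measure E).toSphere

/-- `m` is a median of the function `F` for the probability `P`. -/
def IsMedian {Ω : Type} [MeasurableSpace Ω] (P : Measure Ω) (F : Ω → ℝ) (m : ℝ) : Prop :=
  1 / 2 ≤ P {ω | m ≤ F ω} ∧ 1 / 2 ≤ P {ω | F ω ≤ m}

/-! ### Spherical harmonics -/

/-- The unit sphere `S^d` of `ℝ^(d+1)`. -/
abbrev Sph (d : ℕ) : Type := Metric.sphere (0 : EuclideanSpace ℝ (Fin (d + 1))) 1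

/-- The surface measure of `S^d` (not normalized). -/
def surface (d : ℕ) : Measure (Sph d) :=
  (volume : Measure (EuclideanSpace ℝ (Fin (d + 1)))).toSphere

instance (d : ℕ) : IsFiniteMeasure (surface d) := by unfold surface; infer_instance

/-- The surface area of `S^d`. -/
def volSph (d : ℕ) : ℝ := (surface d).real Set.univ

section Harmonics

variable (𝕂 : Type) [RCLike 𝕂] (d k : ℕ)

/-- The Laplacian `∑ ∂ᵢ²` on polynomials in `d + 1` variables. -/
def laplacian : MvPolynomial (Fin (d + 1)) 𝕂 →ₗ[𝕂] MvPolynomial (Fin (d + 1)) 𝕂 :=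
  ∑ i, (MvPolynomial.pderiv i).toLinearMap ∘ₗ (MvPolynomial.pderiv i).toLinearMap

/-- Homogeneous harmonic polynomials of degree `k` in `d + 1` variables. -/
def harmonicPoly : Submodule 𝕂 (MvPolynomial (Fin (d + 1)) 𝕂) :=
  MvPolynomial.homogeneousSubmodule (Fin (d + 1)) 𝕂 k ⊓ LinearMap.ker (laplacian 𝕂 d)

/-- The `i`-th coordinate function on `S^d`. -/
def coord (i : Fin (d + 1)) : C(Sph d, 𝕂) where
  toFun x := ((x : EuclideanSpace ℝ (Fin (d + 1))) i : 𝕂)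
  continuous_toFun := by fun_prop

/-- Restriction of a polynomial to `S^d`. -/
def restrictSph : MvPolynomial (Fin (d + 1)) 𝕂 →ₗ[𝕂] C(Sph d, 𝕂) :=
  (MvPolynomial.aeval (coord 𝕂 d)).toLinearMap

theorem restrictSph_apply (p : MvPolynomial (Fin (d + 1)) 𝕂) (x : Sph d) :
    restrictSph 𝕂 d p x =
      MvPolynomial.eval (fun i => ((x : EuclideanSpace ℝ (Fin (d + 1))) i : 𝕂)) p := by
  induction p using MvPolynomial.induction_on with
  | C a => simp [restrictSph]
  | add p q hp hq => simp [map_add, hp, hq]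
  | mul_X p i hp =>
    simp only [restrictSph, AlgHom.toLinearMap_apply] at hp
    simp [restrictSph, hp, coord]

/-- The space `E^k` of spherical harmonics of degree `k` with values in `𝕂`, as a subspace of
`L²(S^d; 𝕂)` with the surface measure. -/
def harmonics : Submodule 𝕂 (Lp 𝕂 2 (surface d)) :=
  (harmonicPoly 𝕂 d k).map
    ((ContinuousMap.toLp 2 (surface d) 𝕂).toLinearMap ∘ₗ restrictSph 𝕂 d)

instance : FiniteDimensional 𝕂 (harmonicPoly 𝕂 d k) := by
  have : FiniteDimensional 𝕂 (MvPolynomial.homogeneousSubmodule (Fin (d + 1)) 𝕂 k) :=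
    Module.Finite.iff_fg.mpr (MvPolynomial.homogeneousSubmodule_fg ..)
  exact Submodule.finiteDimensional_inf_left _ _

instance : FiniteDimensional 𝕂 (harmonics 𝕂 d k) := by
  unfold harmonics; infer_instance

instance : FiniteDimensional ℝ (harmonics 𝕂 d k) := Module.Finite.trans 𝕂 _

instance : MeasurableSpace (harmonics 𝕂 d k) := borel _

instance : BorelSpace (harmonics 𝕂 d k) := ⟨rfl⟩

/-- `N_k`, the dimension of `E^k` over `𝕂`. -/
def dimH : ℕ := Module.finrank 𝕂 (harmonics 𝕂 d k)

end Harmonics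

section Norms

variable {𝕂 : Type} [RCLike 𝕂] {d k : ℕ}

/-- The norm of `u` in `L^q(S^d)`. -/
def lqNorm (q : ℝ) (u : harmonics 𝕂 d k) : ℝ :=
  (eLpNorm (u : Lp 𝕂 2 (surface d)) (ENNReal.ofReal q) (surface d)).toReal

/-- Spherical harmonics belong to all `L^q` spaces, so that `lqNorm` is the true norm. -/
theorem memLp_harmonics (p : ℝ≥0∞) (u : harmonics 𝕂 d k) :
    MemLp (u : Lp 𝕂 2 (surface d)) p (surface d) := by
  obtain ⟨u, P, -, rfl⟩ := u
  refine (memLp_congr_ae (ContinuousMap.coeFn_toLp (p := 2) (𝕜 := 𝕂) (surface d) _)).mpr ?_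
  exact (memLp_top_of_bound (ContinuousMap.continuous _).aestronglyMeasurable _
    (Filter.Eventually.of_forall fun x =>
      ContinuousMap.norm_coe_le_norm (restrictSph 𝕂 d P) x)).mono_exponent le_top

end Norms

/-- `m` is a median of the random variable `u ↦ ‖u‖_{L^q}` on the unit sphere of `E^k` with its uniform
probability. -/
def IsLqMedian (𝕂 : Type) [RCLike 𝕂] (d k : ℕ) (q m : ℝ) : Prop :=
  IsMedian (uniformSphere (harmonics 𝕂 d k)) (fun u => lqNorm q u.1) m

/-! ### Random bases -/

section Bases

variable (𝕂 : Type) [RCLike 𝕂] (d : ℕ)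

/-- A reference orthonormal basis of each `E^k`, used to identify the orthonormal bases of `E^k`
with the unitary group. -/
abbrev RefBasis : Type :=
  ∀ k : ℕ, OrthonormalBasis (Fin (dimH 𝕂 d k)) 𝕂 (harmonics 𝕂 d k)

/-- The product of the groups `U(N_k)` (or `O(N_k)`). -/
abbrev BasisSpace : Type := ∀ k : ℕ, UGroup (dimH 𝕂 d k) 𝕂

/-- The product of the Haar probabilities. -/
def basisLaw : Measure (BasisSpace 𝕂 d) :=
  Measure.infinitePi fun k => haarU (dimH 𝕂 d k) 𝕂

variable {𝕂 d}

/-- The `l`-th element of degree `k` of the basis attached to `B`. -/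
def basisElt (e : RefBasis 𝕂 d) (B : BasisSpace 𝕂 d) (k : ℕ) (l : Fin (dimH 𝕂 d k)) :
    harmonics 𝕂 d k :=
  ∑ j, (B k).1 j l • e k j

theorem orthonormal_basisElt (e : RefBasis 𝕂 d) (B : BasisSpace 𝕂 d) (k : ℕ) :
    Orthonormal 𝕂 (basisElt e B k) := by
  rw [orthonormal_iff_ite]
  intro l m
  have h := congrFun (congrFun (Matrix.UnitaryGroup.star_mul_self (B k)) l) m
  rw [Matrix.mul_apply, Matrix.one_apply] at h
  rw [← h]
  simp only [basisElt]
  rw [(e k).orthonormal.inner_sum]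
  simp [Matrix.star_apply]

end Bases

/-- `A_{q,k}`, as a function of `q` and of `N = N_k`. -/
def gammaApprox (d : ℕ) (q : ℝ) (N : ℕ) : ℝ :=
  (N : ℝ) ^ (1 / 2 : ℝ) / volSph d ^ (1 / 2 - 1 / q) *
    (q * (Real.Gamma (q / 2) * Real.Gamma N / (2 * Real.Gamma (q / 2 + N)))) ^ (1 / q)

end SphHarm

end

/-! ### The midpoint Brunn–Minkowski inequality -/

namespace BrunnMinkowski

/-! Everything rests on concentration of measure on the unit sphere of `E^k`. By rotation
invariance, point evaluations on `E^k` all have the same norm, and integrating the reproducing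
kernel on the diagonal gives its value `√(N_k / Vol)`. Interpolating this sup bound with `L²` makes
the `L^q` norm Lipschitz with constant `L = (N_k / Vol)^(1/2 - 1/q)` (`lqNorm_le`). Lévy's
inequality then gives deviations from the median of order `exp(-c N_k r² / L²)`, and `N_k / L²` is
at least a constant times `N_k^(2/q)`, uniformly in `q`.

Lévy's inequality comes with non-sharp constants from the midpoint Brunn–Minkowski inequality: if
`A` and `B` are far apart on the sphere, uniform convexity puts the midpoints of their truncated
cones in a ball of radius less than `1`, so the product of the two measures is exponentially small
in the dimension (`uniformSphere_mul_le`).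

For (1), each `b_{k,l}` is uniform on its sphere by invariance of Haar measure, and a union bound
over `k, l` converges because `N_k > k` and `exp(-c N_k^(2/q))` beats every power of `N_k`. For (2),
`A_{q,k}` is exactly the `q`-th mean of `‖u‖_{L^q}`: by Tonelli it reduces to moments of one
coordinate on a complex sphere, computed by comparing two evaluations of a Gaussian integral. The
triangle inequality in `L^q(P)` bounds its distance to the median by the `q`-th central moment,
which the Gaussian tail makes `O(√q / N_k^(1/q))`. For (3), the values `u(x)` have Gaussian tails
uniform in `k` and `x`, so the medians are bounded in `k`; then `r → ∞` in (1) at countably many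
exponents. -/

theorem volume_add_volume_le_of_isCompact {K L C : Set ℝ} (hK : IsCompact K) (hL : IsCompact L)
    (hK' : K.Nonempty) (hL' : L.Nonempty) (h : ∀ a ∈ K, ∀ b ∈ L, a + b ∈ C) :
    volume K + volume L ≤ volume C := by
  have hM := hK.sSup_mem hK'
  have hm := hL.sInf_mem hL'
  set M := sSup K
  set m := sInf L
  -- The translates `K + min L` and `max K + L` both lie in `C` and meet only at the point `M + m`.
  have e1 : volume ((fun x => x + m) '' K) = volume K := by simp
  have e2 : volume ((fun x => M + x) '' L) = volume L := by simp
  have hdisj : AEDisjoint volume ((fun x => x + m) '' K) ((fun x => M + x) '' L) := by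
    refine measure_mono_null (t := {M + m}) ?_ (by simp)
    rintro _ ⟨⟨a, ha, rfl⟩, ⟨b, hb, hab⟩⟩
    have h1 : a ≤ M := le_csSup hK.bddAbove ha
    have h2 : m ≤ b := csInf_le hL.bddBelow hb
    simp only at hab
    simp only [Set.mem_singleton_iff]
    linarith
  rw [← e1, ← e2, ← measure_union₀ ?_ hdisj]
  · refine measure_mono ?_
    rintro _ (⟨a, ha, rfl⟩ | ⟨b, hb, rfl⟩)
    · exact h a ha m hm
    · exact h M hM b hb
  · exact (hL.image (by fun_prop)).measurableSet.nullMeasurableSet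

theorem volume_add_volume_le {A B C : Set ℝ} (hA : MeasurableSet A) (hB : MeasurableSet B)
    (hA' : A.Nonempty) (hB' : B.Nonempty) (h : ∀ a ∈ A, ∀ b ∈ B, a + b ∈ C) :
    volume A + volume B ≤ volume C := by
  obtain ⟨a₀, ha₀⟩ := hA'
  obtain ⟨b₀, hb₀⟩ := hB'
  have hBC : volume B ≤ volume C := by
    rw [← (show volume ((fun x => a₀ + x) '' B) = volume B by simp)]
    exact measure_mono (by rintro _ ⟨b, hb, rfl⟩; exact h a₀ ha₀ b hb)
  have hAC : volume A ≤ volume C := by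
    rw [← (show volume ((fun x => x + b₀) '' A) = volume A by simp)]
    exact measure_mono (by rintro _ ⟨b, hb, rfl⟩; exact h b hb b₀ hb₀)
  rcases eq_or_ne (volume C) ⊤ with hC | hC
  · simp [hC]
  have hBt : volume B ≠ ⊤ := ne_top_of_le_ne_top hC hBC
  refine add_le_of_le_tsub_right_of_le hBC ?_
  rw [hA.measure_eq_iSup_isCompact]
  refine iSup₂_le fun K hKA => iSup_le fun hK => ENNReal.le_sub_of_add_le_right hBt ?_
  have hKC : volume K ≤ volume C := (measure_mono hKA).trans hAC
  have hKt : volume K ≠ ⊤ := ne_top_of_le_ne_top hC hKC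
  rw [add_comm]
  refine add_le_of_le_tsub_right_of_le hKC ?_
  rw [hB.measure_eq_iSup_isCompact]
  refine iSup₂_le fun L hLB => iSup_le fun hL => ENNReal.le_sub_of_add_le_right hKt ?_
  -- The approximating compact sets may be empty; adjoining `a₀` and `b₀` repairs this without
  -- leaving `A` and `B`.
  have key := volume_add_volume_le_of_isCompact (hK.insert a₀) (hL.insert b₀)
    (Set.insert_nonempty _ _) (Set.insert_nonempty _ _) (C := C) (by
      intro a ha b hb
      exact h a (Set.insert_subset ha₀ hKA ha) b (Set.insert_subset hb₀ hLB hb))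
  rw [add_comm]
  exact (add_le_add (measure_mono (Set.subset_insert _ _))
    (measure_mono (Set.subset_insert _ _))).trans key

theorem volume_add_volume_le_two_mul {A B C : Set ℝ} (hA : MeasurableSet A) (hB : MeasurableSet B)
    (hA' : A.Nonempty) (hB' : B.Nonempty) (h : ∀ a ∈ A, ∀ b ∈ B, (a + b) / 2 ∈ C) :
    volume A + volume B ≤ 2 * volume C := by
  have := volume_add_volume_le hA hB hA' hB' (C := (fun x => x * 2⁻¹) ⁻¹' C)
    (fun a ha b hb => by simpa [div_eq_mul_inv] using h a ha b hb)
  rw [Real.volume_preimage_mul_right (by norm_num)] at this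
  simpa using this

/-- AM–GM, with the larger number written as `x + z` since `(x - y)²` is not available in `ℝ≥0∞`. -/
theorem four_mul_le_sq_add (x y : ℝ≥0∞) : 4 * (x * y) ≤ (x + y) ^ 2 := by
  wlog hxy : x ≤ y generalizing x y
  · rw [mul_comm x, add_comm]; exact this y x (le_of_not_ge hxy)
  obtain ⟨z, rfl⟩ := exists_add_of_le hxy
  calc 4 * (x * (x + z)) ≤ 4 * (x * (x + z)) + z ^ 2 := le_self_add
    _ = (x + (x + z)) ^ 2 := by ring

/-- The one-dimensional Prékopa–Leindler inequality at the midpoint, for functions with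
suprema `a` and `b`. -/
theorem lintegral_mul_lintegral_le_sq_of_isLUB {f g h : ℝ → ℝ} (hf : Measurable f)
    (hg : Measurable g) (hh : Measurable h) (hf0 : 0 ≤ f) (hg0 : 0 ≤ g) (hh0 : 0 ≤ h) {a b : ℝ}
    (ha : IsLUB (Set.range f) a) (hb : IsLUB (Set.range g) b) (ha0 : 0 < a) (hb0 : 0 < b)
    (H : ∀ x y, f x * g y ≤ h ((x + y) / 2) ^ 2) :
    (∫⁻ x, ENNReal.ofReal (f x)) * (∫⁻ x, ENNReal.ofReal (g x)) ≤
      (∫⁻ x, ENNReal.ofReal (h x)) ^ 2 := by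
  set c := Real.sqrt (a * b) with hc
  have hc0 : 0 < c := Real.sqrt_pos.mpr (mul_pos ha0 hb0)
  have hcc : c ^ 2 = a * b := Real.sq_sqrt (mul_pos ha0 hb0).le
  -- After scaling both suprema to `1`, the superlevel sets of `f / a` and `g / b` are nonempty for
  -- exactly the same levels `t < 1`, so the additive one-dimensional inequality applies level by
  -- level in the layer-cake formula.
  have key : (∫⁻ x, ENNReal.ofReal (f x / a)) + (∫⁻ x, ENNReal.ofReal (g x / b)) ≤
      2 * ∫⁻ x, ENNReal.ofReal (h x / c) := by
    rw [lintegral_eq_lintegral_meas_lt volume (.of_forall fun x => div_nonneg (hf0 x) ha0.le)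
        (hf.div_const a).aemeasurable,
      lintegral_eq_lintegral_meas_lt volume (.of_forall fun x => div_nonneg (hg0 x) hb0.le)
        (hg.div_const b).aemeasurable,
      lintegral_eq_lintegral_meas_lt volume (.of_forall fun x => div_nonneg (hh0 x) hc0.le)
        (hh.div_const c).aemeasurable, ← lintegral_add_left,
      ← lintegral_const_mul' _ _ (by simp)]
    · refine setLIntegral_mono' measurableSet_Ioi fun t ht => ?_
      have ht0 : 0 < t := ht
      rcases le_or_gt 1 t with h1 | h1
      · have e1 : {x | t < f x / a} = ∅ := by
          ext x
          simp only [Set.mem_ofPred_eq, Set.mem_empty_iff_false, iff_false, not_lt]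
          exact ((div_le_one ha0).mpr (ha.1 ⟨x, rfl⟩)).trans h1
        have e2 : {x | t < g x / b} = ∅ := by
          ext x
          simp only [Set.mem_ofPred_eq, Set.mem_empty_iff_false, iff_false, not_lt]
          exact ((div_le_one hb0).mpr (hb.1 ⟨x, rfl⟩)).trans h1
        rw [e1, e2]
        simp
      · refine volume_add_volume_le_two_mul (measurableSet_lt measurable_const (hf.div_const a))
          (measurableSet_lt measurable_const (hg.div_const b)) ?_ ?_ ?_
        · obtain ⟨_, ⟨x, rfl⟩, hx, -⟩ := ha.exists_between (show t * a < a by nlinarith)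
          exact ⟨x, (lt_div_iff₀ ha0).mpr hx⟩
        · obtain ⟨_, ⟨x, rfl⟩, hx, -⟩ := hb.exists_between (show t * b < b by nlinarith)
          exact ⟨x, (lt_div_iff₀ hb0).mpr hx⟩
        · intro x hx y hy
          have hx' : t * a < f x := (lt_div_iff₀ ha0).mp hx
          have hy' : t * b < g y := (lt_div_iff₀ hb0).mp hy
          refine (lt_div_iff₀ hc0).mpr ?_
          refine lt_of_pow_lt_pow_left₀ 2 (hh0 _) ?_
          calc (t * c) ^ 2 = (t * a) * (t * b) := by rw [mul_pow, hcc]; ring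
            _ < f x * g y := mul_lt_mul'' hx' hy' (by positivity) (by positivity)
            _ ≤ _ := H x y
    · exact (Antitone.measurable fun s t hst => measure_mono fun x hx => lt_of_le_of_lt hst hx)
  have sc : ∀ (u : ℝ → ℝ) {r : ℝ}, 0 < r →
      ∫⁻ x, ENNReal.ofReal (u x) = ENNReal.ofReal r * ∫⁻ x, ENNReal.ofReal (u x / r) := by
    intro u r hr
    rw [← lintegral_const_mul' _ _ (by simp)]
    refine lintegral_congr fun x => ?_
    rw [← ENNReal.ofReal_mul hr.le, mul_div_cancel₀ _ hr.ne']
  rw [sc f ha0, sc g hb0, sc h hc0, mul_pow, ← ENNReal.ofReal_pow hc0.le, hcc,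
    ENNReal.ofReal_mul ha0.le, mul_mul_mul_comm]
  gcongr
  set X := ∫⁻ x, ENNReal.ofReal (f x / a)
  set Y := ∫⁻ x, ENNReal.ofReal (g x / b)
  set Z := ∫⁻ x, ENNReal.ofReal (h x / c)
  -- AM–GM turns the additive inequality for the normalized functions into the multiplicative one.
  have h4 : 4 * (X * Y) ≤ 4 * Z ^ 2 := by
    calc 4 * (X * Y) ≤ (X + Y) ^ 2 := four_mul_le_sq_add X Y
      _ ≤ (2 * Z) ^ 2 := by gcongr
      _ = 4 * Z ^ 2 := by ring
  exact (ENNReal.mul_le_mul_iff_right (by norm_num) (by norm_num)).mp h4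

theorem lintegral_mul_lintegral_le_sq {f g h : ℝ → ℝ} (hf : Measurable f)
    (hg : Measurable g) (hh : Measurable h) (hf0 : 0 ≤ f) (hg0 : 0 ≤ g) (hh0 : 0 ≤ h)
    (hfb : BddAbove (Set.range f)) (hgb : BddAbove (Set.range g))
    (H : ∀ x y, f x * g y ≤ h ((x + y) / 2) ^ 2) :
    (∫⁻ x, ENNReal.ofReal (f x)) * (∫⁻ x, ENNReal.ofReal (g x)) ≤
      (∫⁻ x, ENNReal.ofReal (h x)) ^ 2 := by
  have hz : ∀ u : ℝ → ℝ, 0 ≤ u → BddAbove (Set.range u) → sSup (Set.range u) ≤ 0 →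
      ∫⁻ x, ENNReal.ofReal (u x) = 0 := by
    intro u _ hb h0
    have : ∀ x, ENNReal.ofReal (u x) = 0 := fun x =>
      ENNReal.ofReal_eq_zero.mpr ((le_csSup hb ⟨x, rfl⟩).trans h0)
    simp [this]
  rcases le_or_gt (sSup (Set.range f)) 0 with h0 | ha0
  · simp [hz f hf0 hfb h0]
  rcases le_or_gt (sSup (Set.range g)) 0 with h0 | hb0
  · simp [hz g hg0 hgb h0]
  exact lintegral_mul_lintegral_le_sq_of_isLUB hf hg hh hf0 hg0 hh0
    (isLUB_csSup (Set.range_nonempty f) hfb) (isLUB_csSup (Set.range_nonempty g) hgb) ha0 hb0 H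

/-- Induction on the dimension by slicing along the first coordinate: the induction hypothesis for
slices at heights `s`, `t` and `(s + t) / 2` is exactly the hypothesis of the one-dimensional
Prékopa–Leindler inequality for the slice volumes. The common radius `R` keeps those volumes finite
and bounded. -/
theorem volume_mul_volume_le_sq_pi : ∀ (n : ℕ) {A B C : Set (Fin n → ℝ)} {R : ℝ},
    MeasurableSet A → MeasurableSet B → MeasurableSet C →
    A ⊆ Metric.closedBall 0 R → B ⊆ Metric.closedBall 0 R → C ⊆ Metric.closedBall 0 R →
    (∀ a ∈ A, ∀ b ∈ B, (2⁻¹ : ℝ) • (a + b) ∈ C) → volume A * volume B ≤ volume C ^ 2 := by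
  intro n
  induction n with
  | zero =>
    intro A B C R hA hB hC _ _ _ h
    rcases A.eq_empty_or_nonempty with rfl | ⟨a, ha⟩
    · simp
    rcases B.eq_empty_or_nonempty with rfl | ⟨b, hb⟩
    · simp
    have hu : ∀ {S : Set (Fin 0 → ℝ)} {x}, x ∈ S → S = Set.univ := fun {S x} hx =>
      Set.eq_univ_of_forall fun y => (Subsingleton.elim x y) ▸ hx
    rw [hu ha, hu hb, hu (h a ha b hb), sq]
  | succ n ih =>
    intro A B C R hA hB hC hAR hBR hCR h
    let e := (MeasurableEquiv.piFinSuccAbove (fun _ : Fin (n + 1) => ℝ) 0).symm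
    have he : ∀ S : Set (Fin (n + 1) → ℝ), MeasurableSet S →
        volume S = ∫⁻ t, volume (Prod.mk t ⁻¹' (e ⁻¹' S)) := by
      intro S hS
      rw [← (volume_preserving_piFinSuccAbove (fun _ : Fin (n + 1) => ℝ) 0).symm.measure_preimage
        hS.nullMeasurableSet]
      exact Measure.prod_apply (e.measurable hS)
    have hm : ∀ S : Set (Fin (n + 1) → ℝ), MeasurableSet S →
        Measurable fun t => volume (Prod.mk t ⁻¹' (e ⁻¹' S)) := fun S hS =>
      measurable_measure_prodMk_left (e.measurable hS)
    have e0 : ∀ t x, e (t, x) 0 = t := fun t x => rfl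
    have es : ∀ t x (i : Fin n), e (t, x) i.succ = x i := fun t x i => rfl
    have hsl : ∀ {S : Set (Fin (n + 1) → ℝ)}, S ⊆ Metric.closedBall 0 R → ∀ t,
        Prod.mk t ⁻¹' (e ⁻¹' S) ⊆ Metric.closedBall 0 R := by
      intro S hS t x hx
      have hx' := hS hx
      rw [mem_closedBall_zero_iff] at hx' ⊢
      have hR : 0 ≤ R := (norm_nonneg _).trans hx'
      refine (pi_norm_le_iff_of_nonneg hR).mpr fun i => ?_
      rw [← es t x i]
      exact (norm_le_pi_norm _ _).trans hx'
    have hV : volume (Metric.closedBall (0 : Fin n → ℝ) R) < ⊤ := measure_closedBall_lt_top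
    have hfin : ∀ {S : Set (Fin (n + 1) → ℝ)}, S ⊆ Metric.closedBall 0 R → ∀ t,
        volume (Prod.mk t ⁻¹' (e ⁻¹' S)) ≠ ⊤ := fun hS t =>
      ne_top_of_le_ne_top hV.ne (measure_mono (hsl hS t))
    have hofr : ∀ {S : Set (Fin (n + 1) → ℝ)}, S ⊆ Metric.closedBall 0 R → MeasurableSet S →
        volume S = ∫⁻ t, ENNReal.ofReal (volume (Prod.mk t ⁻¹' (e ⁻¹' S))).toReal := by
      intro S hS hS'
      rw [he S hS']
      exact lintegral_congr fun t => (ENNReal.ofReal_toReal (hfin hS t)).symm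
    have hbd : ∀ {S : Set (Fin (n + 1) → ℝ)}, S ⊆ Metric.closedBall 0 R →
        BddAbove (Set.range fun t => (volume (Prod.mk t ⁻¹' (e ⁻¹' S))).toReal) := by
      intro S hS
      refine ⟨(volume (Metric.closedBall (0 : Fin n → ℝ) R)).toReal, ?_⟩
      rintro _ ⟨t, rfl⟩
      exact ENNReal.toReal_mono hV.ne (measure_mono (hsl hS t))
    rw [hofr hAR hA, hofr hBR hB, hofr hCR hC]
    refine lintegral_mul_lintegral_le_sq (hm A hA).ennreal_toReal (hm B hB).ennreal_toReal
      (hm C hC).ennreal_toReal (fun _ => ENNReal.toReal_nonneg) (fun _ => ENNReal.toReal_nonneg)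
      (fun _ => ENNReal.toReal_nonneg) (hbd hAR) (hbd hBR) fun s t => ?_
    rw [← ENNReal.toReal_mul, ← ENNReal.toReal_pow]
    refine ENNReal.toReal_mono (ENNReal.pow_ne_top (hfin hCR _)) ?_
    refine ih (measurable_prodMk_left (e.measurable hA)) (measurable_prodMk_left (e.measurable hB))
      (measurable_prodMk_left (e.measurable hC)) (hsl hAR s) (hsl hBR t) (hsl hCR _) ?_
    intro x hx y hy
    have := h _ hx _ hy
    have hEq : e ((s + t) / 2, (2⁻¹ : ℝ) • (x + y)) = (2⁻¹ : ℝ) • (e (s, x) + e (t, y)) := by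
      funext i
      refine Fin.cases ?_ (fun i => ?_) i
      · simp only [Pi.smul_apply, Pi.add_apply, e0, smul_eq_mul]; ring
      · simp only [Pi.smul_apply, Pi.add_apply, es, smul_eq_mul]
    rw [Set.mem_preimage, Set.mem_preimage, hEq]
    exact this

/-- The multiplicative Brunn–Minkowski inequality for midpoints in a finite-dimensional space. -/
theorem measure_mul_measure_le_sq {E : Type*} [NormedAddCommGroup E] [NormedSpace ℝ E]
    [FiniteDimensional ℝ E] [MeasurableSpace E] [BorelSpace E] (μ : Measure E)
    [μ.IsAddHaarMeasure] {A B C : Set E} (hA : MeasurableSet A) (hB : MeasurableSet B)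
    (hC : MeasurableSet C) (hA' : Bornology.IsBounded A) (hB' : Bornology.IsBounded B)
    (hC' : Bornology.IsBounded C) (h : ∀ a ∈ A, ∀ b ∈ B, (2⁻¹ : ℝ) • (a + b) ∈ C) :
    μ A * μ B ≤ μ C ^ 2 := by
  let e : E ≃L[ℝ] (Fin (Module.finrank ℝ E) → ℝ) :=
    ContinuousLinearEquiv.ofFinrankEq (by simp)
  have hH : (μ.map e).IsAddHaarMeasure := e.isAddHaarMeasure_map μ
  -- Both sides of the inequality are quadratic in the measure, so the constant `c` is harmless.
  obtain ⟨c, hc⟩ : ∃ c : ℝ≥0∞, μ.map e = c • volume :=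
    ⟨_, Measure.isAddLeftInvariant_eq_smul (μ.map e) volume⟩
  have hS : ∀ S : Set E, μ S = c * volume (e.symm ⁻¹' S) := by
    intro S
    have h1 : μ.map e (e.symm ⁻¹' S) = μ S := by
      have := (e.toHomeomorph.toMeasurableEquiv).map_apply (μ := μ) (e.symm ⁻¹' S)
      refine this.trans ?_
      congr 1
      ext x
      simp
    rw [← h1, hc]
    simp
  have hbd : ∀ S : Set E, Bornology.IsBounded S → ∃ R, e.symm ⁻¹' S ⊆ Metric.closedBall 0 R := by
    intro S hS
    have : Bornology.IsBounded (e '' S) := e.lipschitz.isBounded_image hS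
    rw [← e.image_eq_preimage_symm]
    exact this.subset_closedBall 0
  obtain ⟨R₁, h1⟩ := hbd A hA'
  obtain ⟨R₂, h2⟩ := hbd B hB'
  obtain ⟨R₃, h3⟩ := hbd C hC'
  have key := volume_mul_volume_le_sq_pi _ (R := max R₁ (max R₂ R₃))
    (e.symm.continuous.measurable hA) (e.symm.continuous.measurable hB)
    (e.symm.continuous.measurable hC)
    (h1.trans (Metric.closedBall_subset_closedBall (by simp)))
    (h2.trans (Metric.closedBall_subset_closedBall (by simp)))
    (h3.trans (Metric.closedBall_subset_closedBall (by simp)))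
    (fun a ha b hb => by
      have := h _ ha _ hb
      simpa [Set.mem_preimage, map_smul, map_add] using this)
  rw [hS A, hS B, hS C, mul_pow, mul_mul_mul_comm, sq c]
  gcongr

end BrunnMinkowski

/-! ### Concentration of measure on the sphere -/

namespace SphHarm

section Sphere

variable {E : Type} [NormedAddCommGroup E] [NormedSpace ℝ E] [FiniteDimensional ℝ E]
  [MeasurableSpace E] [BorelSpace E]

/-- The open unit cone over a subset of the sphere, with the apex removed. -/
def unitCone (s : Set (Metric.sphere (0 : E) 1)) : Set E :=
  {x | x ∈ Metric.ball (0 : E) 1 ∧ ‖x‖⁻¹ • x ∈ ((↑) '' s : Set E)}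

omit [FiniteDimensional ℝ E] [MeasurableSpace E] [BorelSpace E] in
-- Links the description by direction `‖x‖⁻¹ • x`, convenient for measurability and for isometries,
-- with the product set through which `Measure.toSphere` is computed.
theorem unitCone_eq_smul (s : Set (Metric.sphere (0 : E) 1)) :
    unitCone s = open scoped Pointwise in Set.Ioo (0 : ℝ) 1 • ((↑) '' s : Set E) := by
  ext x
  rw [Set.mem_smul]
  constructor
  · rintro ⟨hx, y, hy, hyx⟩
    have hx0 : 0 < ‖x‖ := by
      rw [norm_pos_iff]
      rintro rfl
      have := mem_sphere_zero_iff_norm.mp y.2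
      rw [hyx] at this
      simp at this
    refine ⟨‖x‖, ⟨hx0, by simpa using hx⟩, y, ⟨y, hy, rfl⟩, ?_⟩
    rw [hyx, smul_inv_smul₀ hx0.ne']
  · rintro ⟨t, ht, _, ⟨y, hy, rfl⟩, rfl⟩
    have hy1 : ‖(y : E)‖ = 1 := mem_sphere_zero_iff_norm.mp y.2
    have hn : ‖t • (y : E)‖ = t := by rw [norm_smul, hy1, mul_one, Real.norm_of_nonneg ht.1.le]
    refine ⟨by rw [mem_ball_zero_iff, hn]; exact ht.2, y, hy, ?_⟩
    rw [hn, inv_smul_smul₀ ht.1.ne']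

theorem measurableSet_unitCone {s : Set (Metric.sphere (0 : E) 1)} (hs : MeasurableSet s) :
    MeasurableSet (unitCone s) := by
  have h : Measurable fun x : E => ‖x‖⁻¹ • x := measurable_norm.inv.smul measurable_id
  exact measurableSet_ball.inter
    (h (MeasurableSet.subtype_image Metric.isClosed_sphere.measurableSet hs))

omit [FiniteDimensional ℝ E] in
theorem toSphere_eq_unitCone (μ : Measure E) {s : Set (Metric.sphere (0 : E) 1)}
    (hs : MeasurableSet s) : μ.toSphere s = Module.finrank ℝ E * μ (unitCone s) := by
  rw [μ.toSphere_apply' hs, unitCone_eq_smul]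

theorem uniformSphere_eq_unitCone [Nontrivial E] {s : Set (Metric.sphere (0 : E) 1)}
    (hs : MeasurableSet s) :
    uniformSphere E s = (Measure.addHaar (Metric.ball (0 : E) 1))⁻¹ *
      Measure.addHaar (unitCone s) := by
  have hn : (Module.finrank ℝ E : ℝ≥0∞) ≠ 0 := by
    exact_mod_cast (Module.finrank_pos (R := ℝ) (M := E)).ne'
  rw [uniformSphere, Measure.smul_apply, smul_eq_mul, toSphere_eq_unitCone _ hs,
    Measure.toSphere_apply_univ, ENNReal.mul_inv (.inl hn) (.inl (by simp)),
    mul_mul_mul_comm, ENNReal.inv_mul_cancel hn (by simp), one_mul]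

instance [Nontrivial E] : IsProbabilityMeasure (uniformSphere E) := by
  constructor
  rw [uniformSphere, Measure.smul_apply, smul_eq_mul]
  refine ENNReal.inv_mul_cancel ?_ (measure_ne_top _ _)
  exact (Measure.measure_univ_ne_zero).mpr (Measure.toSphere_ne_zero _)

/-- Points of norm below `1/2` lie in the half-size copy of the cone, whose measure is at most half
of the total. Discarding them matters because angular separation is lost near the apex. -/
theorem addHaar_unitCone_le [Nontrivial E] (μ : Measure E) [μ.IsAddHaarMeasure]
    (s : Set (Metric.sphere (0 : E) 1)) :
    μ (unitCone s) ≤ 2 * μ (unitCone s ∩ {x | 1 / 2 ≤ ‖x‖}) := by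
  have hfin : μ (unitCone s) ≠ ⊤ :=
    ne_top_of_le_ne_top (measure_ball_lt_top (x := (0 : E)) (r := 1)).ne
      (measure_mono fun x hx => hx.1)
  have h1 : μ (unitCone s) ≤ μ (unitCone s ∩ {x | 1 / 2 ≤ ‖x‖}) + 2⁻¹ * μ (unitCone s) := by
    have hsub : unitCone s ⊆ (unitCone s ∩ {x | 1 / 2 ≤ ‖x‖}) ∪
        (open scoped Pointwise in (2⁻¹ : ℝ) • unitCone s) := by
      intro x hx
      rcases le_or_gt (1 / 2) ‖x‖ with h | h
      · exact .inl ⟨hx, h⟩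
      · refine .inr ((Set.mem_inv_smul_set_iff₀ two_ne_zero _ _).mpr ⟨?_, ?_⟩)
        · rw [mem_ball_zero_iff, norm_smul, Real.norm_of_nonneg zero_le_two]
          linarith
        · have := hx.2
          rw [norm_smul, Real.norm_of_nonneg zero_le_two, mul_inv, mul_comm, mul_smul,
            inv_smul_smul₀ two_ne_zero]
          exact this
    refine (measure_mono hsub).trans ((measure_union_le _ _).trans ?_)
    gcongr
    rw [Measure.addHaar_smul]
    gcongr
    rw [← ENNReal.ofReal_ofNat, ← ENNReal.ofReal_inv_of_pos zero_lt_two]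
    refine ENNReal.ofReal_le_ofReal ?_
    rw [abs_of_pos (by positivity)]
    exact pow_le_of_le_one (by norm_num) (by norm_num) (Module.finrank_pos (R := ℝ) (M := E)).ne'
  have h2 : μ (unitCone s) = 2⁻¹ * μ (unitCone s) + 2⁻¹ * μ (unitCone s) := by
    rw [← add_mul, ENNReal.inv_two_add_inv_two, one_mul]
  have h3 : 2⁻¹ * μ (unitCone s) ≤ μ (unitCone s ∩ {x | 1 / 2 ≤ ‖x‖}) := by
    refine (ENNReal.add_le_add_iff_right (a := 2⁻¹ * μ (unitCone s))
      (ENNReal.mul_ne_top (by simp) hfin)).mp ?_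
    rw [← h2]; exact h1
  calc μ (unitCone s) = 2 * (2⁻¹ * μ (unitCone s)) := by
        rw [← mul_assoc, ENNReal.mul_inv_cancel two_ne_zero (by simp), one_mul]
    _ ≤ _ := by gcongr

omit [FiniteDimensional ℝ E] [MeasurableSpace E] [BorelSpace E] in
-- The reverse triangle inequality gives `|t - s| ≤ ‖s • a - t • b‖`, so moving `t • b` to radius
-- `s` at most doubles the distance; dividing by `s ≥ 1/2` gives the factor `4`.
theorem norm_sub_le_of_cone {a b : E} (ha : ‖a‖ = 1) (hb : ‖b‖ = 1) {s t : ℝ} (hs : 1 / 2 ≤ s)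
    (ht : 1 / 2 ≤ t) : ‖a - b‖ ≤ 4 * ‖s • a - t • b‖ := by
  have hs0 : 0 < s := by linarith
  have h1 : s * ‖a - b‖ ≤ ‖s • a - t • b‖ + |t - s| := by
    calc s * ‖a - b‖ = ‖s • (a - b)‖ := by rw [norm_smul, Real.norm_of_nonneg hs0.le]
      _ = ‖(s • a - t • b) + (t - s) • b‖ := by congr 1; module
      _ ≤ _ := (norm_add_le _ _).trans (by rw [norm_smul, hb, mul_one, Real.norm_eq_abs])
  have h2 : |t - s| ≤ ‖s • a - t • b‖ := by
    have := abs_norm_sub_norm_le (t • b) (s • a)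
    rwa [norm_smul, norm_smul, ha, hb, mul_one, mul_one, Real.norm_of_nonneg hs0.le,
      Real.norm_of_nonneg (by linarith), norm_sub_rev] at this
  nlinarith [norm_nonneg (a - b)]

/-- Two subsets of the sphere at distance `δ` cannot both be large. -/
theorem uniformSphere_mul_le [Nontrivial E]
    (hpar : ∀ x y : E, ‖x + y‖ ^ 2 + ‖x - y‖ ^ 2 ≤ 2 * (‖x‖ ^ 2 + ‖y‖ ^ 2))
    {A B : Set (Metric.sphere (0 : E) 1)} (hA : MeasurableSet A) (hB : MeasurableSet B) {δ : ℝ}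
    (hδ : 0 ≤ δ) (hAB : ∀ a ∈ A, ∀ b ∈ B, δ ≤ ‖(a : E) - b‖) :
    uniformSphere E A * uniformSphere E B ≤
      ENNReal.ofReal (4 * Real.exp (-(Module.finrank ℝ E * δ ^ 2 / 64))) := by
  rcases A.eq_empty_or_nonempty with rfl | ⟨a₀, ha₀⟩
  · simp
  rcases B.eq_empty_or_nonempty with rfl | ⟨b₀, hb₀⟩
  · simp
  have hδ2 : δ ≤ 2 := (hAB a₀ ha₀ b₀ hb₀).trans ((norm_sub_le _ _).trans (by
    rw [mem_sphere_zero_iff_norm.mp a₀.2, mem_sphere_zero_iff_norm.mp b₀.2]; norm_num))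
  set n := Module.finrank ℝ E
  set μ : Measure E := Measure.addHaar
  -- Truncated cone points satisfy `‖x - y‖ ≥ δ / 4`, so `‖(x + y) / 2‖² ≤ 1 - ‖x - y‖² / 4 ≤ 1 - δ²
  -- / 64` by `hpar`.
  set ρ := Real.sqrt (1 - δ ^ 2 / 64)
  have hρ : ρ ^ 2 = 1 - δ ^ 2 / 64 := Real.sq_sqrt (by nlinarith)
  have hρ0 : 0 ≤ ρ := Real.sqrt_nonneg _
  have hmeas : MeasurableSet {x : E | 1 / 2 ≤ ‖x‖} := measurableSet_le measurable_const measurable_norm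
  have hbdd : ∀ s : Set (Metric.sphere (0 : E) 1),
      Bornology.IsBounded (unitCone s ∩ {x | 1 / 2 ≤ ‖x‖}) := fun s =>
    Metric.isBounded_ball.subset fun x hx => hx.1.1
  have hBM := BrunnMinkowski.measure_mul_measure_le_sq μ
    (A := unitCone A ∩ {x | 1 / 2 ≤ ‖x‖}) (B := unitCone B ∩ {x | 1 / 2 ≤ ‖x‖})
    (C := Metric.closedBall 0 ρ) ((measurableSet_unitCone hA).inter hmeas)
    ((measurableSet_unitCone hB).inter hmeas) measurableSet_closedBall (hbdd A) (hbdd B)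
    Metric.isBounded_closedBall (by
      rintro x ⟨⟨hx1, a, ha, hxa⟩, hx2⟩ y ⟨⟨hy1, b, hb, hyb⟩, hy2⟩
      rw [Set.mem_ofPred_eq] at hx2 hy2
      rw [mem_ball_zero_iff] at hx1 hy1
      have e1 : ‖x‖ • (a : E) = x := by
        rw [hxa, smul_inv_smul₀]; linarith
      have e2 : ‖y‖ • (b : E) = y := by
        rw [hyb, smul_inv_smul₀]; linarith
      have h4 : δ ≤ 4 * ‖x - y‖ := by
        have := norm_sub_le_of_cone (mem_sphere_zero_iff_norm.mp a.2)
          (mem_sphere_zero_iff_norm.mp b.2) hx2 hy2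
        rw [e1, e2] at this
        exact (hAB a ha b hb).trans this
      rw [mem_closedBall_zero_iff]
      refine le_of_sq_le_sq ?_ hρ0
      rw [hρ, norm_smul, mul_pow, Real.norm_of_nonneg (by norm_num)]
      have := hpar x y
      nlinarith [norm_nonneg x, norm_nonneg y, norm_nonneg (x - y)])
  have hb0 : μ (Metric.ball 0 1) ≠ 0 := (Metric.measure_ball_pos μ _ one_pos).ne'
  have hbt : μ (Metric.ball 0 1) ≠ ⊤ := measure_ball_lt_top.ne
  rw [Measure.addHaar_closedBall _ _ hρ0] at hBM
  rw [uniformSphere_eq_unitCone hA, uniformSphere_eq_unitCone hB]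
  set V := μ (Metric.ball 0 1)
  calc V⁻¹ * μ (unitCone A) * (V⁻¹ * μ (unitCone B))
      ≤ V⁻¹ * (2 * μ (unitCone A ∩ {x | 1 / 2 ≤ ‖x‖})) *
        (V⁻¹ * (2 * μ (unitCone B ∩ {x | 1 / 2 ≤ ‖x‖}))) := by
        gcongr <;> exact addHaar_unitCone_le μ _
    _ = 4 * (V⁻¹ ^ 2 * (μ (unitCone A ∩ {x | 1 / 2 ≤ ‖x‖}) *
        μ (unitCone B ∩ {x | 1 / 2 ≤ ‖x‖}))) := by ring
    _ ≤ 4 * (V⁻¹ ^ 2 * (ENNReal.ofReal (ρ ^ n) * V) ^ 2) := by gcongr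
    _ = 4 * ENNReal.ofReal (ρ ^ n) ^ 2 * (V⁻¹ * V) ^ 2 := by ring
    _ = ENNReal.ofReal (4 * (ρ ^ n) ^ 2) := by
        rw [ENNReal.inv_mul_cancel hb0 hbt, one_pow, mul_one, ← ENNReal.ofReal_pow (by positivity),
          ENNReal.ofReal_mul (by norm_num), ENNReal.ofReal_ofNat]
    _ ≤ _ := by
        refine ENNReal.ofReal_le_ofReal ?_
        rw [← pow_mul, mul_comm n 2, pow_mul, hρ]
        gcongr
        calc (1 - δ ^ 2 / 64) ^ n ≤ Real.exp (-(δ ^ 2 / 64)) ^ n := by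
              gcongr
              · nlinarith
              · have := Real.add_one_le_exp (-(δ ^ 2 / 64)); linarith
          _ = _ := by rw [← Real.exp_nat_mul]; congr 1; ring

/-- Lévy's inequality: a Lipschitz function on the sphere is concentrated around its median. -/
theorem uniformSphere_abs_sub_median_le [Nontrivial E]
    (hpar : ∀ x y : E, ‖x + y‖ ^ 2 + ‖x - y‖ ^ 2 ≤ 2 * (‖x‖ ^ 2 + ‖y‖ ^ 2))
    {F : Metric.sphere (0 : E) 1 → ℝ} (hF : Measurable F) {L : ℝ} (hL : 0 < L)
    (hFL : ∀ u v, |F u - F v| ≤ L * ‖(u : E) - v‖) {M : ℝ} (hM : IsMedian (uniformSphere E) F M)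
    {r : ℝ} (hr : 0 ≤ r) :
    uniformSphere E {u | r < |F u - M|} ≤
      ENNReal.ofReal (16 * Real.exp (-(Module.finrank ℝ E * (r / L) ^ 2 / 64))) := by
  set n := Module.finrank ℝ E
  -- Sets on which `F` differs by at least `r` are at distance at least `r / L`. One side of the
  -- median has mass at least `1/2`, which turns the product bound `4` into `8`; the two tails add
  -- up to `16`.
  have key : ∀ {A B : Set (Metric.sphere (0 : E) 1)}, MeasurableSet A → MeasurableSet B →
      1 / 2 ≤ uniformSphere E A → (∀ a ∈ A, ∀ b ∈ B, r ≤ |F a - F b|) →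
      uniformSphere E B ≤ ENNReal.ofReal (8 * Real.exp (-(n * (r / L) ^ 2 / 64))) := by
    intro A B hA hB hA2 h
    have := uniformSphere_mul_le hpar hA hB (δ := r / L) (by positivity) fun a ha b hb =>
      (div_le_iff₀' hL).mpr ((h a ha b hb).trans (hFL a b))
    calc uniformSphere E B = 2 * (1 / 2 * uniformSphere E B) := by
          rw [← mul_assoc, one_div, ENNReal.mul_inv_cancel two_ne_zero (by simp), one_mul]
      _ ≤ 2 * (uniformSphere E A * uniformSphere E B) := by gcongr
      _ ≤ 2 * ENNReal.ofReal (4 * Real.exp (-(n * (r / L) ^ 2 / 64))) := by gcongr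
      _ = _ := by
          rw [← ENNReal.ofReal_ofNat, ← ENNReal.ofReal_mul zero_le_two, ← mul_assoc]; norm_num
  have hsub : {u | r < |F u - M|} ⊆ {u | M + r ≤ F u} ∪ {u | F u ≤ M - r} := by
    intro u hu
    have hu : r < |F u - M| := hu
    rcases lt_abs.mp hu with h | h
    · left; show M + r ≤ F u; linarith
    · right; show F u ≤ M - r; linarith
  refine (measure_mono hsub).trans ((measure_union_le _ _).trans ?_)
  rw [show (16 : ℝ) = 8 + 8 by norm_num, add_mul, ENNReal.ofReal_add (by positivity) (by positivity)]
  refine add_le_add ?_ ?_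
  · refine key (measurableSet_le hF measurable_const) (measurableSet_le measurable_const hF) hM.2 ?_
    intro a (ha : F a ≤ M) b (hb : M + r ≤ F b)
    rw [abs_sub_comm]
    exact le_trans (by linarith) (le_abs_self _)
  · refine key (measurableSet_le measurable_const hF) (measurableSet_le hF measurable_const) hM.1 ?_
    intro a (ha : M ≤ F a) b (hb : F b ≤ M - r)
    exact le_trans (by linarith) (le_abs_self _)

/-! ### Invariance under isometries -/

/-- A linear isometry acting on the unit sphere. -/
def sphereMap (T : E ≃ₗᵢ[ℝ] E) (u : Metric.sphere (0 : E) 1) : Metric.sphere (0 : E) 1 :=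
  ⟨T u, by simp⟩

omit [FiniteDimensional ℝ E] [MeasurableSpace E] [BorelSpace E] in
theorem continuous_sphereMap (T : E ≃ₗᵢ[ℝ] E) : Continuous (sphereMap T) :=
  (T.continuous.comp continuous_subtype_val).subtype_mk _

/-- A linear map scales Haar measure by a constant; since the unit ball is its own preimage, that
constant is `1`. -/
theorem addHaar_preimage_linearIsometryEquiv (μ : Measure E) [μ.IsAddHaarMeasure]
    (T : E ≃ₗᵢ[ℝ] E) (s : Set E) : μ (T ⁻¹' s) = μ s := by
  have hdet : LinearMap.det (T.toLinearEquiv : E →ₗ[ℝ] E) ≠ 0 :=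
    T.toLinearEquiv.isUnit_det'.ne_zero
  have h := fun s => Measure.addHaar_preimage_linearMap μ hdet s
  have h1 := h (Metric.ball 0 1)
  have e : ((T.toLinearEquiv : E →ₗ[ℝ] E) : E → E) ⁻¹' (Metric.ball 0 1) = Metric.ball 0 1 := by
    ext x; simp
  rw [e] at h1
  have hb0 : μ (Metric.ball 0 1) ≠ 0 := (Metric.measure_ball_pos μ _ one_pos).ne'
  have hbt : μ (Metric.ball 0 1) ≠ ⊤ := measure_ball_lt_top.ne
  have h2 : ENNReal.ofReal |(LinearMap.det (T.toLinearEquiv : E →ₗ[ℝ] E))⁻¹| = 1 := by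
    refine (ENNReal.mul_left_inj hb0 hbt).mp ?_
    rw [one_mul]; exact h1.symm
  have h3 := h s
  rw [h2, one_mul] at h3
  exact h3

theorem measurePreserving_sphereMap_toSphere (μ : Measure E) [μ.IsAddHaarMeasure]
    (T : E ≃ₗᵢ[ℝ] E) : MeasurePreserving (sphereMap T) μ.toSphere μ.toSphere := by
  refine ⟨(continuous_sphereMap T).measurable, ?_⟩
  ext s hs
  rw [Measure.map_apply (continuous_sphereMap T).measurable hs,
    toSphere_eq_unitCone _ ((continuous_sphereMap T).measurable hs), toSphere_eq_unitCone _ hs,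
    ← addHaar_preimage_linearIsometryEquiv μ T (unitCone s)]
  congr 2
  ext x
  simp only [unitCone, Set.mem_ofPred_eq, Set.mem_preimage, mem_ball_zero_iff, T.norm_map]
  refine and_congr_right fun _ => ⟨?_, ?_⟩
  · rintro ⟨y, hy, hyx⟩
    exact ⟨sphereMap T y, hy, by simp [sphereMap, hyx]⟩
  · rintro ⟨y, hy, hyx⟩
    refine ⟨sphereMap T.symm y, ?_, ?_⟩
    · show sphereMap T (sphereMap T.symm y) ∈ s
      convert! hy
      ext; simp [sphereMap]
    · simp [sphereMap, hyx]

theorem measurePreserving_sphereMap (T : E ≃ₗᵢ[ℝ] E) :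
    MeasurePreserving (sphereMap T) (uniformSphere E) (uniformSphere E) :=
  (measurePreserving_sphereMap_toSphere _ T).smul_measure _

/-- Gaussian tails of linear functionals on the sphere. -/
theorem uniformSphere_abs_linear_le [Nontrivial E]
    (hpar : ∀ x y : E, ‖x + y‖ ^ 2 + ‖x - y‖ ^ 2 ≤ 2 * (‖x‖ ^ 2 + ‖y‖ ^ 2))
    (f : E →ₗ[ℝ] ℝ) {L : ℝ} (hL : 0 < L) (hf : ∀ x, |f x| ≤ L * ‖x‖) {r : ℝ} (hr : 0 ≤ r) :
    uniformSphere E {u | r < |f u|} ≤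
      ENNReal.ofReal (16 * Real.exp (-(Module.finrank ℝ E * (r / L) ^ 2 / 64))) := by
  have hmeas : Measurable fun u : Metric.sphere (0 : E) 1 => f u :=
    (f.continuous_of_finiteDimensional.comp continuous_subtype_val).measurable
  -- The antipodal symmetry `u ↦ -u` makes `0` a median of `f`.
  have hneg : uniformSphere E {u | 0 ≤ f u} = uniformSphere E {u | f u ≤ 0} := by
    rw [← (measurePreserving_sphereMap (LinearIsometryEquiv.neg ℝ)).measure_preimage
      (measurableSet_le measurable_const hmeas).nullMeasurableSet]
    congr 1
    ext u
    simp [sphereMap]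
  have hcov : 1 ≤ uniformSphere E {u | 0 ≤ f u} + uniformSphere E {u | f u ≤ 0} := by
    rw [← measure_univ (μ := uniformSphere E)]
    refine (measure_mono ?_).trans (measure_union_le _ _)
    intro u _
    exact le_total 0 (f u)
  have hmed : IsMedian (uniformSphere E) (fun u => f u) 0 := by
    have h2 : 1 / 2 ≤ uniformSphere E {u | f u ≤ 0} := by
      rw [hneg, ← two_mul] at hcov
      exact ENNReal.div_le_of_le_mul' hcov
    exact ⟨hneg ▸ h2, h2⟩
  simpa using uniformSphere_abs_sub_median_le hpar hmeas hL
    (fun u v => by rw [← map_sub]; exact hf _) hmed hr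

end Sphere

/-- Every real random variable has a median. -/
theorem exists_isMedian {Ω : Type} [MeasurableSpace Ω] (P : Measure Ω) [IsProbabilityMeasure P]
    {F : Ω → ℝ} (hF : Measurable F) : ∃ m, IsMedian P F m := by
  have : IsProbabilityMeasure (P.map F) := Measure.isProbabilityMeasure_map hF.aemeasurable
  let G := ProbabilityTheory.cdf (P.map F)
  have hG : ∀ x, ENNReal.ofReal (G x) = P {ω | F ω ≤ x} := fun x => by
    rw [ProbabilityTheory.ofReal_cdf, Measure.map_apply hF measurableSet_Iic]; rfl
  -- The median is `sInf S`: the lower condition follows by approaching it from the left, the upper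
  -- one from right continuity of `G`.
  let S : Set ℝ := {x | 1 / 2 ≤ G x}
  have hne : S.Nonempty := by
    obtain ⟨x, hx⟩ := ((ProbabilityTheory.tendsto_cdf_atTop (P.map F)).eventually
      (lt_mem_nhds (show (1 / 2 : ℝ) < 1 by norm_num))).exists
    exact ⟨x, hx.le⟩
  have hbd : BddBelow S := by
    obtain ⟨x, hx⟩ := ((ProbabilityTheory.tendsto_cdf_atBot (P.map F)).eventually
      (gt_mem_nhds (show (0 : ℝ) < 1 / 2 by norm_num))).exists
    refine ⟨x, fun y hy => ?_⟩
    by_contra! h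
    have : G y ≤ G x := G.mono h.le
    exact absurd hy (not_le.mpr (this.trans_lt hx))
  have half : (1 / 2 : ℝ≥0∞) = ENNReal.ofReal (1 / 2) := by
    rw [ENNReal.ofReal_div_of_pos two_pos]; simp
  refine ⟨sInf S, ?_, ?_⟩
  · have hlt : P {ω | F ω < sInf S} ≤ 1 / 2 := by
      have hU : {ω | F ω < sInf S} = ⋃ k : ℕ, {ω | F ω ≤ sInf S - 1 / (k + 1)} := by
        ext ω
        simp only [Set.mem_ofPred_eq, Set.mem_iUnion]
        constructor
        · intro h
          obtain ⟨k, hk⟩ := exists_nat_one_div_lt (sub_pos.mpr h)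
          exact ⟨k, by linarith⟩
        · rintro ⟨k, hk⟩
          have : (0 : ℝ) < 1 / (k + 1) := by positivity
          linarith
      rw [hU, Monotone.measure_iUnion]
      · refine iSup_le fun k => ?_
        rw [← hG, half]
        refine ENNReal.ofReal_le_ofReal ?_
        by_contra! h
        have h1 : sInf S ≤ sInf S - 1 / ((k : ℝ) + 1) := csInf_le hbd h.le
        have : (0 : ℝ) < 1 / (k + 1) := by positivity
        linarith
      · intro i j hij ω (h : F ω ≤ _)
        refine le_trans h ?_
        have : (1 : ℝ) / (j + 1) ≤ 1 / (i + 1) := by gcongr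
        linarith
    have hc : {ω | sInf S ≤ F ω} = {ω | F ω < sInf S}ᶜ := by ext; simp
    rw [hc, prob_compl_eq_one_sub (measurableSet_lt hF measurable_const)]
    refine ENNReal.le_sub_of_add_le_left (by simp [ne_top_of_le_ne_top _ hlt]) ?_
    calc P {ω | F ω < sInf S} + 1 / 2 ≤ 1 / 2 + 1 / 2 := by gcongr
      _ = 1 := ENNReal.add_halves 1
  · rw [← hG, half]
    refine ENNReal.ofReal_le_ofReal ?_
    have hr := G.right_continuous (sInf S)
    have hr' : Filter.Tendsto G (nhdsWithin (sInf S) (Set.Ioi (sInf S))) (nhds (G (sInf S))) :=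
      hr.mono_left (nhdsWithin_mono _ Set.Ioi_subset_Ici_self)
    refine ge_of_tendsto hr' ?_
    filter_upwards [self_mem_nhdsWithin] with x hx
    obtain ⟨y, hy, hyx⟩ := (csInf_lt_iff hbd hne).mp hx
    exact le_trans hy (G.mono hyx.le)

end SphHarm

/-! ### Moments of random variables with Gaussian tails -/

namespace SphHarm

/-- From `s ≤ exp s` at `s = t / (2x)` one gets `t ^ x ≤ (2x) ^ x * exp (t / 2)`; what remains of
Euler's integral is `∫ exp (-t / 2) = 2`. -/
theorem gamma_add_one_le {x : ℝ} (hx : 0 < x) : Real.Gamma (x + 1) ≤ 2 * (2 * x) ^ x := by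
  have hint : IntegrableOn (fun t : ℝ => (2 * x) ^ x * Real.exp (-(1 / 2) * t)) (Set.Ioi 0) :=
    (integrableOn_exp_mul_Ioi (by norm_num) 0).const_mul _
  have h2 : ∫ t in Set.Ioi (0 : ℝ), (2 * x) ^ x * Real.exp (-(1 / 2) * t) = 2 * (2 * x) ^ x := by
    rw [integral_const_mul, integral_exp_mul_Ioi (by norm_num)]
    norm_num
    ring
  rw [Real.Gamma_eq_integral (by linarith), ← h2]
  refine setIntegral_mono_on (Real.GammaIntegral_convergent (by linarith)) hint measurableSet_Ioi
    fun t ht => ?_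
  have ht0 : 0 < t := ht
  have h3 : (t / (2 * x)) ^ x ≤ Real.exp (t / 2) := by
    calc (t / (2 * x)) ^ x ≤ (Real.exp (t / (2 * x))) ^ x := by
          gcongr
          have := Real.add_one_le_exp (t / (2 * x))
          linarith
      _ = _ := by rw [← Real.exp_mul]; congr 1; field_simp
  have h4 : t ^ x ≤ (2 * x) ^ x * Real.exp (t / 2) := by
    rw [Real.div_rpow ht0.le (by positivity), div_le_iff₀' (by positivity)] at h3
    exact h3
  rw [add_sub_cancel_right]
  calc Real.exp (-t) * t ^ x ≤ Real.exp (-t) * ((2 * x) ^ x * Real.exp (t / 2)) := by gcongr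
    _ = (2 * x) ^ x * (Real.exp (-t) * Real.exp (t / 2)) := by ring
    _ = _ := by rw [← Real.exp_add]; congr 2; ring

variable {Ω : Type} [MeasurableSpace Ω]

theorem lintegral_rpow_le_gamma (P : Measure Ω) {f : Ω → ℝ} (hf : Measurable f)
    (hf0 : 0 ≤ f) {K a q : ℝ} (hK : 0 ≤ K) (ha : 0 < a) (hq : 0 < q)
    (h : ∀ t, 0 ≤ t → P {ω | t < f ω} ≤ ENNReal.ofReal (K * Real.exp (-(a * t ^ 2)))) :
    ∫⁻ ω, ENNReal.ofReal (f ω ^ q) ∂P ≤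
      ENNReal.ofReal (K * (a ^ (-q / 2) * Real.Gamma (q / 2 + 1))) := by
  rw [lintegral_rpow_eq_lintegral_meas_lt_mul P (.of_forall hf0) hf.aemeasurable hq]
  have hI : ∫ t in Set.Ioi (0 : ℝ), t ^ (q - 1) * Real.exp (-a * t ^ (2 : ℝ)) =
      a ^ (-q / 2) * (1 / 2) * Real.Gamma (q / 2) := by
    rw [integral_rpow_mul_exp_neg_mul_rpow two_pos (by linarith) ha]
    congr 3 <;> ring_nf
  have hint : IntegrableOn (fun t : ℝ => t ^ (q - 1) * Real.exp (-a * t ^ (2 : ℝ))) (Set.Ioi 0) :=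
    integrableOn_rpow_mul_exp_neg_mul_rpow (by linarith) (by norm_num) ha
  calc ENNReal.ofReal q * ∫⁻ t in Set.Ioi (0 : ℝ), P {ω | t < f ω} * ENNReal.ofReal (t ^ (q - 1))
      ≤ ENNReal.ofReal q * ∫⁻ t in Set.Ioi (0 : ℝ),
        ENNReal.ofReal (K * (t ^ (q - 1) * Real.exp (-a * t ^ (2 : ℝ)))) := by
        refine mul_le_mul' le_rfl (setLIntegral_mono' measurableSet_Ioi fun t ht => ?_)
        have ht0 : 0 < t := ht
        refine (mul_le_mul' (h t ht0.le) le_rfl).trans ?_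
        rw [← ENNReal.ofReal_mul (by positivity)]
        refine ENNReal.ofReal_le_ofReal (le_of_eq ?_)
        rw [Real.rpow_two, neg_mul]; ring
    _ = ENNReal.ofReal q * ENNReal.ofReal (K * (a ^ (-q / 2) * (1 / 2) * Real.Gamma (q / 2))) := by
        rw [← hI, ← integral_const_mul, ofReal_integral_eq_lintegral_ofReal (hint.const_mul K)]
        filter_upwards [ae_restrict_mem measurableSet_Ioi] with t ht
        have ht0 : (0 : ℝ) < t := ht
        show 0 ≤ K * (t ^ (q - 1) * Real.exp (-a * t ^ (2 : ℝ)))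
        positivity
    _ = _ := by
        rw [← ENNReal.ofReal_mul hq.le, Real.Gamma_add_one (by positivity)]
        congr 1
        ring

/-- The origin of the factor `√q`: the moment of a Gaussian tail is governed by `Γ(q/2 + 1)`, whose
`q`-th root grows like `√q`. The prefactor is absorbed in the `q`-th power because `2 * K ≥ 1` and
`q ≥ 1`. -/
theorem lintegral_rpow_le_of_tail (P : Measure Ω) {f : Ω → ℝ} (hf : Measurable f)
    (hf0 : 0 ≤ f) {K a q : ℝ} (hK : 1 ≤ K) (ha : 0 < a) (hq : 1 ≤ q)
    (h : ∀ t, 0 ≤ t → P {ω | t < f ω} ≤ ENNReal.ofReal (K * Real.exp (-(a * t ^ 2)))) :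
    ∫⁻ ω, ENNReal.ofReal (f ω ^ q) ∂P ≤ ENNReal.ofReal ((2 * K * Real.sqrt q / Real.sqrt a) ^ q) := by
  refine (lintegral_rpow_le_gamma P hf hf0 (by linarith) ha (by linarith) h).trans
    (ENNReal.ofReal_le_ofReal ?_)
  have hq0 : 0 < q := by linarith
  have h1 := gamma_add_one_le (show 0 < q / 2 by positivity)
  rw [mul_div_cancel₀ _ two_ne_zero] at h1
  have hs : Real.sqrt q ^ q = q ^ (q / 2) := by
    rw [Real.sqrt_eq_rpow, ← Real.rpow_mul hq0.le]; congr 1; ring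
  have hsa : Real.sqrt a ^ q = a ^ (q / 2) := by
    rw [Real.sqrt_eq_rpow, ← Real.rpow_mul ha.le]; congr 1; ring
  have h2K : 2 * K ≤ (2 * K) ^ q := by
    calc 2 * K = (2 * K) ^ (1 : ℝ) := (Real.rpow_one _).symm
      _ ≤ _ := Real.rpow_le_rpow_of_exponent_le (by linarith) hq
  calc K * (a ^ (-q / 2) * Real.Gamma (q / 2 + 1))
      ≤ K * (a ^ (-q / 2) * (2 * q ^ (q / 2))) := by gcongr
    _ = (2 * K) * q ^ (q / 2) * a ^ (-q / 2) := by ring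
    _ ≤ (2 * K) ^ q * q ^ (q / 2) * a ^ (-q / 2) := by gcongr
    _ = _ := by
        rw [Real.div_rpow (by positivity) (by positivity), Real.mul_rpow (x := 2 * K) (by positivity)
          (by positivity), hs, hsa, neg_div, Real.rpow_neg ha.le]
        rfl

end SphHarm

/-! ### Spherical harmonics: dimension, evaluation, rotations -/

namespace SphHarm

noncomputable section

variable {𝕂 : Type} [RCLike 𝕂] {d k : ℕ}

theorem laplacian_apply (p : MvPolynomial (Fin (d + 1)) 𝕂) :
    laplacian 𝕂 d p = ∑ i, MvPolynomial.pderiv i (MvPolynomial.pderiv i p) := by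
  simp [laplacian]

/-- Linear substitution of variables. -/
def linSubst (c : Fin (d + 1) → Fin (d + 1) → 𝕂) :
    MvPolynomial (Fin (d + 1)) 𝕂 →ₐ[𝕂] MvPolynomial (Fin (d + 1)) 𝕂 :=
  MvPolynomial.aeval fun j => ∑ i, MvPolynomial.C (c j i) * MvPolynomial.X i

theorem eval_linSubst (c : Fin (d + 1) → Fin (d + 1) → 𝕂) (x : Fin (d + 1) → 𝕂)
    (p : MvPolynomial (Fin (d + 1)) 𝕂) :
    MvPolynomial.eval x (linSubst c p) = MvPolynomial.eval (fun j => ∑ i, c j i * x i) p := by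
  induction p using MvPolynomial.induction_on with
  | C a => simp [linSubst]
  | add p q hp hq => simp [map_add, hp, hq]
  | mul_X p l hp => rw [map_mul, map_mul, hp]; simp [linSubst]

theorem pderiv_linSubst (c : Fin (d + 1) → Fin (d + 1) → 𝕂) (i : Fin (d + 1))
    (p : MvPolynomial (Fin (d + 1)) 𝕂) :
    MvPolynomial.pderiv i (linSubst c p) =
      ∑ j, MvPolynomial.C (c j i) * linSubst c (MvPolynomial.pderiv j p) := by
  induction p using MvPolynomial.induction_on with
  | C a => simp [linSubst]
  | add p q hp hq => simp [map_add, hp, hq, mul_add, Finset.sum_add_distrib]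
  | mul_X p l hp =>
    have h1 : MvPolynomial.pderiv i (linSubst c (MvPolynomial.X l)) = MvPolynomial.C (c l i) := by
      simp [linSubst, MvPolynomial.pderiv_X, Pi.single_apply]
    simp only [map_mul, MvPolynomial.pderiv_mul, h1, hp, MvPolynomial.pderiv_X, map_add, mul_add,
      Finset.sum_add_distrib, Pi.single_apply]
    congr 1
    · rw [Finset.sum_mul]
      exact Finset.sum_congr rfl fun j _ => by ring
    · simp only [apply_ite (linSubst c), map_one, map_zero, mul_ite, mul_one, mul_zero,
        Finset.sum_ite_eq, Finset.mem_univ, if_true]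
      rw [mul_comm]

/-- The chain rule produces the matrix of bilinear row products. There is no conjugation in `hc`:
the coefficients used later are those of a real orthogonal matrix, even for `𝕂 = ℂ`. -/
theorem laplacian_linSubst {c : Fin (d + 1) → Fin (d + 1) → 𝕂}
    (hc : ∀ j l, ∑ i, c j i * c l i = if j = l then 1 else 0)
    (p : MvPolynomial (Fin (d + 1)) 𝕂) :
    laplacian 𝕂 d (linSubst c p) = linSubst c (laplacian 𝕂 d p) := by
  simp only [laplacian_apply, pderiv_linSubst, map_sum, MvPolynomial.pderiv_C_mul, Finset.mul_sum]
  rw [Finset.sum_comm]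
  refine Finset.sum_congr rfl fun j _ => ?_
  rw [Finset.sum_comm]
  have : ∀ l, ∑ i, MvPolynomial.C (c j i) * (MvPolynomial.C (c l i) *
      linSubst c (MvPolynomial.pderiv l (MvPolynomial.pderiv j p))) =
      if j = l then linSubst c (MvPolynomial.pderiv j (MvPolynomial.pderiv j p)) else 0 := by
    intro l
    simp only [← mul_assoc, ← map_mul, ← Finset.sum_mul, ← map_sum, hc]
    split_ifs with h
    · simp [h]
    · simp
  simp [this]

theorem linSubst_mem_harmonicPoly {c : Fin (d + 1) → Fin (d + 1) → 𝕂}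
    (hc : ∀ j l, ∑ i, c j i * c l i = if j = l then 1 else 0)
    {p : MvPolynomial (Fin (d + 1)) 𝕂} (hp : p ∈ harmonicPoly 𝕂 d k) :
    linSubst c p ∈ harmonicPoly 𝕂 d k := by
  refine ⟨?_, ?_⟩
  · have h1 : p.IsHomogeneous k := hp.1
    have h2 := h1.aeval (n := 1) (fun j => ∑ i, MvPolynomial.C (c j i) * MvPolynomial.X i)
      (fun j => MvPolynomial.IsHomogeneous.sum _ _ _ fun i _ =>
        MvPolynomial.isHomogeneous_C_mul_X _ _)
    rw [one_mul] at h2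
    exact h2
  · have h1 : laplacian 𝕂 d p = 0 := hp.2
    show laplacian 𝕂 d (linSubst c p) = 0
    rw [laplacian_linSubst hc, h1, map_zero]

theorem eval_mul_of_isHomogeneous {σ : Type} {p : MvPolynomial σ 𝕂} (hp : p.IsHomogeneous k)
    (t : 𝕂) (x : σ → 𝕂) :
    MvPolynomial.eval (fun i => t * x i) p = t ^ k * MvPolynomial.eval x p := by
  rw [MvPolynomial.eval_eq, MvPolynomial.eval_eq, Finset.mul_sum]
  refine Finset.sum_congr rfl fun m hm => ?_
  have : ∑ i ∈ m.support, m i = k := by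
    have := hp.degree_eq_sum_deg_support hm
    simpa using this.symm
  simp_rw [mul_pow, Finset.prod_mul_distrib, Finset.prod_pow_eq_pow_sum, this]
  ring

/-- Homogeneity spreads the vanishing from the sphere to all nonzero real vectors; these contain a
product of infinite sets, on which only the zero polynomial vanishes. -/
theorem eq_zero_of_restrictSph_eq_zero {p : MvPolynomial (Fin (d + 1)) 𝕂}
    (hp : p.IsHomogeneous k) (h : restrictSph 𝕂 d p = 0) : p = 0 := by
  refine MvPolynomial.funext_set (fun _ => (fun r : ℝ => (r : 𝕂)) '' {0}ᶜ) (fun _ => ?_) ?_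
  · refine Set.Infinite.image (fun x _ y _ hxy => RCLike.ofReal_injective hxy) ?_
    exact (Set.finite_singleton (0 : ℝ)).infinite_compl
  · intro x hx
    choose v hv hvx using fun i => hx i (Set.mem_univ i)
    have hxv : x = fun i => (v i : 𝕂) := funext fun i => (hvx i).symm
    let w : EuclideanSpace ℝ (Fin (d + 1)) := WithLp.toLp 2 v
    have hw : w ≠ 0 := fun h0 => hv 0 (by simpa [w] using congrArg (fun z => z 0) h0)
    have hw' : ‖w‖ ≠ 0 := norm_ne_zero_iff.mpr hw
    have hs : ‖w‖⁻¹ • w ∈ Metric.sphere (0 : EuclideanSpace ℝ (Fin (d + 1))) 1 := by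
      rw [mem_sphere_zero_iff_norm, norm_smul, norm_inv, norm_norm, inv_mul_cancel₀ hw']
    have h1 := restrictSph_apply 𝕂 d p ⟨_, hs⟩
    rw [h, ContinuousMap.zero_apply] at h1
    have h2 : x = fun i => ((‖w‖ : ℝ) : 𝕂) * (((‖w‖⁻¹ • w : EuclideanSpace ℝ (Fin (d + 1))) i : ℝ) : 𝕂) := by
      rw [hxv]
      funext i
      rw [← RCLike.ofReal_mul, PiLp.smul_apply, smul_eq_mul, mul_inv_cancel_left₀ hw']
    rw [map_zero, h2, eval_mul_of_isHomogeneous hp]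
    simp only at h1
    rw [← h1, mul_zero]

theorem finrank_le_finrank_ker {V W : Type*} [AddCommGroup V] [Module 𝕂 V] [AddCommGroup W]
    [Module 𝕂 W] [FiniteDimensional 𝕂 V] (T : V →ₗ[𝕂] V) (c : V →ₗ[𝕂] W)
    (hc : Function.Surjective c) (h : c ∘ₗ T = 0) :
    Module.finrank 𝕂 W ≤ Module.finrank 𝕂 (LinearMap.ker T) := by
  have h1 := T.finrank_range_add_finrank_ker
  have h2 := c.finrank_range_add_finrank_ker
  rw [LinearMap.range_eq_top.mpr hc, finrank_top] at h2
  have h3 : LinearMap.range T ≤ LinearMap.ker c := by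
    rintro _ ⟨x, rfl⟩
    exact LinearMap.congr_fun h x
  have h4 := Submodule.finrank_mono h3
  omega

/-- Multiplying by `X 0 ^ 2` restores the degree lost by the Laplacian, giving an endomorphism of
the degree `k` polynomials. For `k ≤ 1` the truncated degree `k - 2 + 2` is wrong, but the Laplacian
vanishes. -/
theorem X_sq_mul_laplacian_isHomogeneous {p : MvPolynomial (Fin (d + 1)) 𝕂}
    (hp : p.IsHomogeneous k) :
    (MvPolynomial.X 0 ^ 2 * laplacian 𝕂 d p : MvPolynomial (Fin (d + 1)) 𝕂).IsHomogeneous k := by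
  rw [laplacian_apply]
  rcases le_or_gt k 1 with hk | hk
  · have : ∀ i, MvPolynomial.pderiv i (MvPolynomial.pderiv i p) = 0 := by
      intro i
      have h0 : (MvPolynomial.pderiv i p).IsHomogeneous 0 := by
        have := hp.pderiv (i := i)
        rwa [Nat.sub_eq_zero_of_le hk] at this
      rw [MvPolynomial.totalDegree_eq_zero_iff_eq_C.mp
        (Nat.le_zero.mp h0.totalDegree_le), MvPolynomial.pderiv_C]
    simp only [this, Finset.sum_const_zero, mul_zero]
    exact MvPolynomial.isHomogeneous_zero _ _ _
  · have h := (MvPolynomial.isHomogeneous_X_pow (R := 𝕂) (0 : Fin (d + 1)) 2).mul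
      (MvPolynomial.IsHomogeneous.sum Finset.univ _ _ fun i _ => (hp.pderiv (i := i)).pderiv (i := i))
    convert h using 1
    omega

/-- Harmonic polynomials form the kernel of `p ↦ X 0 ^ 2 * Δ p`. Its image consists of multiples of
`X 0 ^ 2`, so it is killed by the coefficients of the `k + 1` monomials `X₁^a X₂^(k-a)`; hence the
kernel has dimension at least `k + 1`. Three variables are needed, which is where `d ≥ 2` enters. -/
theorem lt_finrank_harmonicPoly (hd : 2 ≤ d) :
    k < Module.finrank 𝕂 (harmonicPoly 𝕂 d k) := by
  let P := MvPolynomial.homogeneousSubmodule (Fin (d + 1)) 𝕂 k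
  have : FiniteDimensional 𝕂 P :=
    Module.Finite.iff_fg.mpr (MvPolynomial.homogeneousSubmodule_fg ..)
  let T₀ : MvPolynomial (Fin (d + 1)) 𝕂 →ₗ[𝕂] MvPolynomial (Fin (d + 1)) 𝕂 :=
    LinearMap.mulLeft 𝕂 (MvPolynomial.X 0 ^ 2) ∘ₗ laplacian 𝕂 d
  let T : P →ₗ[𝕂] P := (T₀ ∘ₗ P.subtype).codRestrict P fun p =>
    X_sq_mul_laplacian_isHomogeneous p.2
  let i₁ : Fin (d + 1) := ⟨1, by omega⟩
  let i₂ : Fin (d + 1) := ⟨2, by omega⟩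
  have h12 : i₁ ≠ i₂ := by simp [i₁, i₂]
  have h01 : (0 : Fin (d + 1)) ≠ i₁ := by simp [i₁, Fin.ext_iff]
  have h02 : (0 : Fin (d + 1)) ≠ i₂ := by simp [i₂, Fin.ext_iff]
  let e : Fin (k + 1) → Fin (d + 1) →₀ ℕ := fun a =>
    Finsupp.single i₁ (a : ℕ) + Finsupp.single i₂ (k - a)
  have he1 : ∀ a, e a i₁ = a := fun a => by simp [e, h12]
  have he0 : ∀ a, e a 0 = 0 := fun a => by simp [e, h01, h02]
  have hinj : Function.Injective e := fun a b hab =>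
    Fin.ext (by rw [← he1 a, ← he1 b, hab])
  have hdeg : ∀ a, (e a).degree = k := fun a => by
    simp only [e, map_add, Finsupp.degree_single]
    have := a.2
    omega
  let c : P →ₗ[𝕂] (Fin (k + 1) → 𝕂) :=
    (LinearMap.pi fun a => MvPolynomial.lcoeff 𝕂 (e a)) ∘ₗ P.subtype
  have hc : Function.Surjective c := by
    intro y
    refine ⟨⟨∑ a, MvPolynomial.monomial (e a) (y a), ?_⟩, ?_⟩
    · exact Submodule.sum_mem _ fun a _ => MvPolynomial.isHomogeneous_monomial _ (hdeg a)
    · funext b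
      simp [c, MvPolynomial.coeff_monomial, hinj.eq_iff]
  have hcT : c ∘ₗ T = 0 := by
    ext p b
    show MvPolynomial.coeff (e b) (MvPolynomial.X 0 ^ 2 * laplacian 𝕂 d p) = 0
    rw [MvPolynomial.X_pow_eq_monomial, MvPolynomial.coeff_monomial_mul', if_neg]
    intro hle
    have := hle 0
    rw [he0] at this
    simp at this
  have h := finrank_le_finrank_ker T c hc hcT
  rw [Module.finrank_fin_fun] at h
  refine lt_of_lt_of_le (Nat.lt_succ_self k) (h.trans ?_)
  let J : LinearMap.ker T →ₗ[𝕂] harmonicPoly 𝕂 d k :=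
    (P.subtype ∘ₗ (LinearMap.ker T).subtype).codRestrict _ fun p => by
      refine ⟨p.1.2, ?_⟩
      have h1 : (MvPolynomial.X 0 ^ 2 * laplacian 𝕂 d p.1.1 : MvPolynomial (Fin (d + 1)) 𝕂) = 0 :=
        congrArg Subtype.val p.2
      exact (mul_eq_zero.mp h1).resolve_left (pow_ne_zero _ (MvPolynomial.X_ne_zero _))
  exact LinearMap.finrank_le_finrank_of_injective (f := J) fun p q hpq =>
    Subtype.ext (Subtype.ext (congrArg (fun z => z.1) hpq))

instance (d : ℕ) : (surface d).IsOpenPosMeasure := by unfold surface; infer_instance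

/-- A harmonic polynomial is determined by its restriction to the sphere. -/
def harmonicPolyEquiv (𝕂 : Type) [RCLike 𝕂] (d k : ℕ) :
    harmonicPoly 𝕂 d k ≃ₗ[𝕂] harmonics 𝕂 d k :=
  LinearEquiv.ofBijective
    ((((ContinuousMap.toLp 2 (surface d) 𝕂).toLinearMap ∘ₗ restrictSph 𝕂 d).submoduleMap
      (harmonicPoly 𝕂 d k)) : harmonicPoly 𝕂 d k →ₗ[𝕂] harmonics 𝕂 d k) <| by
    refine ⟨(injective_iff_map_eq_zero _).mpr fun p hp => ?_, LinearMap.submoduleMap_surjective _ _⟩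
    have h1 : ContinuousMap.toLp 2 (surface d) 𝕂 (restrictSph 𝕂 d p) = 0 := congrArg Subtype.val hp
    have h2 : restrictSph 𝕂 d p = 0 :=
      ContinuousMap.toLp_injective (p := 2) (𝕜 := 𝕂) (surface d) (h1.trans (map_zero _).symm)
    exact Subtype.ext (eq_zero_of_restrictSph_eq_zero p.2.1 h2)

theorem lt_dimH (𝕂 : Type) [RCLike 𝕂] {d : ℕ} (k : ℕ) (hd : 2 ≤ d) : k < dimH 𝕂 d k := by
  rw [dimH, ← (harmonicPolyEquiv 𝕂 d k).finrank_eq]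
  exact lt_finrank_harmonicPoly hd

/-- The continuous representative of a spherical harmonic. -/
def contRep (𝕂 : Type) [RCLike 𝕂] (d k : ℕ) : harmonics 𝕂 d k →ₗ[𝕂] C(Sph d, 𝕂) :=
  restrictSph 𝕂 d ∘ₗ (harmonicPoly 𝕂 d k).subtype ∘ₗ (harmonicPolyEquiv 𝕂 d k).symm.toLinearMap

theorem toLp_contRep (u : harmonics 𝕂 d k) :
    ContinuousMap.toLp 2 (surface d) 𝕂 (contRep 𝕂 d k u) = u :=
  congrArg Subtype.val ((harmonicPolyEquiv 𝕂 d k).apply_symm_apply u)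

theorem coeFn_ae_eq_contRep (u : harmonics 𝕂 d k) :
    (u : Lp 𝕂 2 (surface d)) =ᵐ[surface d] contRep 𝕂 d k u := by
  conv_lhs => rw [← toLp_contRep u]
  exact ContinuousMap.coeFn_toLp _ _

/-- An isometry of the ambient space acting on the sphere `S^d`. -/
abbrev rot (R : EuclideanSpace ℝ (Fin (d + 1)) ≃ₗᵢ[ℝ] EuclideanSpace ℝ (Fin (d + 1))) :
    Sph d → Sph d := sphereMap R

theorem measurePreserving_rot
    (R : EuclideanSpace ℝ (Fin (d + 1)) ≃ₗᵢ[ℝ] EuclideanSpace ℝ (Fin (d + 1))) :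
    MeasurePreserving (rot R) (surface d) (surface d) :=
  measurePreserving_sphereMap_toSphere _ R

/-- Composition with `R` is substitution by its orthogonal matrix, which preserves harmonic
polynomials, and `R` preserves the surface measure. -/
theorem exists_contRep_rot
    (R : EuclideanSpace ℝ (Fin (d + 1)) ≃ₗᵢ[ℝ] EuclideanSpace ℝ (Fin (d + 1)))
    (u : harmonics 𝕂 d k) :
    ∃ v : harmonics 𝕂 d k, ‖v‖ = ‖u‖ ∧ ∀ x, contRep 𝕂 d k v x = contRep 𝕂 d k u (rot R x) := by
  let b := EuclideanSpace.basisFun (Fin (d + 1)) ℝ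
  have hRb : ∀ j i, R (b i) j = inner ℝ (R.symm (b j)) (b i) := by
    intro j i
    rw [← R.inner_map_map, R.apply_symm_apply]
    simp [b, EuclideanSpace.inner_single_left]
  let c : Fin (d + 1) → Fin (d + 1) → 𝕂 := fun j i => ((R (b i) j : ℝ) : 𝕂)
  have hc : ∀ j l, ∑ i, c j i * c l i = if j = l then 1 else 0 := by
    intro j l
    have h1 : ∑ i, R (b i) j * R (b i) l = if j = l then 1 else 0 := by
      have h2 := b.sum_inner_mul_inner (R.symm (b j)) (R.symm (b l))
      rw [R.symm.inner_map_map, orthonormal_iff_ite.mp b.orthonormal] at h2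
      rw [← h2]
      refine Finset.sum_congr rfl fun i _ => ?_
      rw [hRb, hRb, real_inner_comm (b i) (R.symm (b l))]
    simp only [c, ← RCLike.ofReal_mul, ← RCLike.ofReal_sum, h1]
    split_ifs <;> simp
  let p := (harmonicPolyEquiv 𝕂 d k).symm u
  let q : harmonicPoly 𝕂 d k := ⟨linSubst c p, linSubst_mem_harmonicPoly hc p.2⟩
  have hx : ∀ x, contRep 𝕂 d k (harmonicPolyEquiv 𝕂 d k q) x = contRep 𝕂 d k u (rot R x) := by
    intro x
    simp only [contRep, LinearMap.comp_apply, LinearEquiv.coe_coe, LinearEquiv.symm_apply_apply,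
      Submodule.subtype_apply, restrictSph_apply]
    show MvPolynomial.eval _ (linSubst c (p : MvPolynomial (Fin (d + 1)) 𝕂)) = MvPolynomial.eval _ p.1
    rw [eval_linSubst]
    refine congrArg (fun y => MvPolynomial.eval y p.1) (funext fun j => ?_)
    have h1 : R (x : EuclideanSpace ℝ (Fin (d + 1))) j = ∑ i, R (b i) j * x.1 i := by
      conv_lhs => rw [← b.sum_repr x.1]
      simp [b, mul_comm]
    show _ = ((R (x : EuclideanSpace ℝ (Fin (d + 1))) j : ℝ) : 𝕂)
    rw [h1]
    simp [c]
  refine ⟨harmonicPolyEquiv 𝕂 d k q, ?_, hx⟩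
  have hn : ∀ w : harmonics 𝕂 d k, ‖w‖ = (eLpNorm (contRep 𝕂 d k w) 2 (surface d)).toReal := by
    intro w
    rw [← eLpNorm_congr_ae (coeFn_ae_eq_contRep w)]
    rfl
  rw [hn, hn, ← eLpNorm_comp_measurePreserving
    (contRep 𝕂 d k u).continuous.aestronglyMeasurable (measurePreserving_rot R)]
  congr 2
  exact funext hx

end

end SphHarm

/-! ### The `L^q` norms of spherical harmonics -/

namespace SphHarm

noncomputable section

variable {𝕂 : Type} [RCLike 𝕂] {d k : ℕ}

theorem volSph_pos (d : ℕ) : 0 < volSph d := by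
  unfold volSph
  refine ENNReal.toReal_pos ?_ (measure_ne_top _ _)
  rw [Measure.measure_univ_ne_zero]
  exact Measure.toSphere_ne_zero _

theorem ofReal_volSph (d : ℕ) : ENNReal.ofReal (volSph d) = surface d Set.univ :=
  ENNReal.ofReal_toReal (measure_ne_top _ _)

theorem ofReal_lqNorm (q : ℝ) (u : harmonics 𝕂 d k) :
    ENNReal.ofReal (lqNorm q u) = eLpNorm (contRep 𝕂 d k u) (ENNReal.ofReal q) (surface d) := by
  rw [lqNorm, ENNReal.ofReal_toReal (memLp_harmonics _ u).eLpNorm_ne_top,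
    eLpNorm_congr_ae (coeFn_ae_eq_contRep u)]

theorem lqNorm_nonneg (q : ℝ) (u : harmonics 𝕂 d k) : 0 ≤ lqNorm q u := ENNReal.toReal_nonneg

theorem lintegral_contRep_rpow {q : ℝ} (hq : 0 < q) (u : harmonics 𝕂 d k) :
    ∫⁻ x, ENNReal.ofReal (‖contRep 𝕂 d k u x‖ ^ q) ∂surface d =
      ENNReal.ofReal (lqNorm q u ^ q) := by
  rw [← ENNReal.ofReal_rpow_of_nonneg (lqNorm_nonneg q u) hq.le, ofReal_lqNorm,
    eLpNorm_eq_lintegral_rpow_enorm_toReal (by simpa using hq) (by simp), ENNReal.toReal_ofReal hq.le,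
    ← ENNReal.rpow_mul, one_div, inv_mul_cancel₀ hq.ne', ENNReal.rpow_one]
  refine lintegral_congr fun x => ?_
  rw [← ENNReal.ofReal_rpow_of_nonneg (norm_nonneg _) hq.le, ofReal_norm]

theorem lqNorm_two (u : harmonics 𝕂 d k) : lqNorm 2 u = ‖u‖ := by
  rw [lqNorm, ENNReal.ofReal_ofNat]; rfl

theorem lqNorm_add_le {q : ℝ} (hq : 1 ≤ q) (u v : harmonics 𝕂 d k) :
    lqNorm q (u + v) ≤ lqNorm q u + lqNorm q v := by
  rw [← ENNReal.ofReal_le_ofReal_iff (add_nonneg (lqNorm_nonneg _ _) (lqNorm_nonneg _ _)),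
    ENNReal.ofReal_add (lqNorm_nonneg _ _) (lqNorm_nonneg _ _), ofReal_lqNorm, ofReal_lqNorm,
    ofReal_lqNorm, map_add]
  exact eLpNorm_add_le (ContinuousMap.continuous _).aestronglyMeasurable
    (ContinuousMap.continuous _).aestronglyMeasurable (by simpa using hq)

theorem lqNorm_neg (q : ℝ) (u : harmonics 𝕂 d k) : lqNorm q (-u) = lqNorm q u := by
  rw [← ENNReal.ofReal_eq_ofReal_iff (lqNorm_nonneg _ _) (lqNorm_nonneg _ _), ofReal_lqNorm,
    ofReal_lqNorm, map_neg]
  exact eLpNorm_neg _ _ _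

theorem abs_lqNorm_sub_le {q : ℝ} (hq : 1 ≤ q) (u v : harmonics 𝕂 d k) :
    |lqNorm q u - lqNorm q v| ≤ lqNorm q (u - v) := by
  have h1 := lqNorm_add_le hq (u - v) v
  have h2 := lqNorm_add_le hq (-(u - v)) u
  rw [lqNorm_neg] at h2
  rw [sub_add_cancel] at h1
  rw [show -(u - v) + u = v by abel] at h2
  rw [abs_le]
  constructor <;> linarith

/-- Evaluation of spherical harmonics at a point. -/
def evalCLM (𝕂 : Type) [RCLike 𝕂] {d : ℕ} (k : ℕ) (x : Sph d) : harmonics 𝕂 d k →L[𝕂] 𝕂 :=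
  LinearMap.toContinuousLinearMap
    ((ContinuousMap.evalCLM 𝕂 x : C(Sph d, 𝕂) →L[𝕂] 𝕂).toLinearMap ∘ₗ contRep 𝕂 d k)

@[simp]
theorem evalCLM_apply (x : Sph d) (u : harmonics 𝕂 d k) :
    evalCLM 𝕂 k x u = contRep 𝕂 d k u x := rfl

/-- The reflection in the hyperplane orthogonal to `y - x` carries `y` to `x`, and composing with it
preserves norms in `E^k`. -/
theorem norm_evalCLM_le (x y : Sph d) : ‖evalCLM 𝕂 k x‖ ≤ ‖evalCLM 𝕂 k y‖ := by
  refine ContinuousLinearMap.opNorm_le_bound _ (ContinuousLinearMap.opNorm_nonneg _) fun u => ?_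
  have hxy : ‖(y : EuclideanSpace ℝ (Fin (d + 1)))‖ = ‖(x : EuclideanSpace ℝ (Fin (d + 1)))‖ := by
    rw [mem_sphere_zero_iff_norm.mp x.2, mem_sphere_zero_iff_norm.mp y.2]
  let R := (ℝ ∙ ((y : EuclideanSpace ℝ (Fin (d + 1))) - x))ᗮ.reflection
  obtain ⟨v, hv, hvx⟩ := exists_contRep_rot R u
  have hR : rot R y = x := Subtype.ext (Submodule.reflection_sub hxy)
  rw [evalCLM_apply, ← hR, ← hvx, ← hv]
  exact (evalCLM 𝕂 k y).le_opNorm v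

theorem norm_evalCLM_eq (x y : Sph d) : ‖evalCLM 𝕂 k x‖ = ‖evalCLM 𝕂 k y‖ :=
  le_antisymm (norm_evalCLM_le x y) (norm_evalCLM_le y x)

/-- The vector representing evaluation at `x`. -/
def reprVec (𝕂 : Type) [RCLike 𝕂] {d : ℕ} (k : ℕ) (x : Sph d) : harmonics 𝕂 d k :=
  haveI := FiniteDimensional.complete 𝕂 (harmonics 𝕂 d k)
  (InnerProductSpace.toDual 𝕂 (harmonics 𝕂 d k)).symm (evalCLM 𝕂 k x)

theorem inner_reprVec (x : Sph d) (u : harmonics 𝕂 d k) :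
    inner 𝕂 (reprVec 𝕂 k x) u = contRep 𝕂 d k u x := by
  have := FiniteDimensional.complete 𝕂 (harmonics 𝕂 d k)
  simp [reprVec]

theorem norm_reprVec (x : Sph d) : ‖reprVec 𝕂 k x‖ = ‖evalCLM 𝕂 k x‖ := by
  have := FiniteDimensional.complete 𝕂 (harmonics 𝕂 d k)
  exact (InnerProductSpace.toDual 𝕂 (harmonics 𝕂 d k)).symm.norm_map _

/-- For an orthonormal basis, `∑ |b_j(y)|²` is the squared norm of evaluation at `y`, hence constant
in `y`; its integral over the sphere is the number of basis elements. -/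
theorem norm_evalCLM_sq (x : Sph d) : ‖evalCLM 𝕂 k x‖ ^ 2 = dimH 𝕂 d k / volSph d := by
  let b := stdOrthonormalBasis 𝕂 (harmonics 𝕂 d k)
  have hsum : ∀ y : Sph d, ∑ j, ‖contRep 𝕂 d k (b j) y‖ ^ 2 = ‖evalCLM 𝕂 k x‖ ^ 2 := by
    intro y
    rw [norm_evalCLM_eq x y, ← norm_reprVec, ← b.sum_sq_norm_inner_left]
    simp_rw [inner_reprVec]
  have hc0 := ContinuousLinearMap.opNorm_nonneg (evalCLM 𝕂 k x)
  generalize ‖evalCLM 𝕂 k x‖ = c at hsum hc0 ⊢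
  have h1 : ∀ j, ∫⁻ y, ENNReal.ofReal (‖contRep 𝕂 d k (b j) y‖ ^ 2) ∂surface d = 1 := by
    intro j
    have := lintegral_contRep_rpow two_pos (b j)
    have e : lqNorm 2 (b j) = 1 := (lqNorm_two (b j)).trans (b.orthonormal.1 j)
    have e' : ENNReal.ofReal (lqNorm 2 (b j) ^ (2 : ℝ)) = 1 := by
      rw [e, Real.one_rpow, ENNReal.ofReal_one]
    refine Eq.trans (lintegral_congr fun y => ?_) (this.trans e')
    exact congrArg ENNReal.ofReal (Real.rpow_two _).symm
  have h2 : ∫⁻ y, ∑ j, ENNReal.ofReal (‖contRep 𝕂 d k (b j) y‖ ^ 2) ∂surface d =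
      dimH 𝕂 d k := by
    rw [lintegral_finsetSum]
    · rw [Finset.sum_congr rfl fun j _ => h1 j]
      simp [dimH]
    · exact fun j _ => ((contRep 𝕂 d k (b j)).continuous.norm.pow 2).measurable.ennreal_ofReal
  have h3 : ∀ y, ∑ j, ENNReal.ofReal (‖contRep 𝕂 d k (b j) y‖ ^ 2) = ENNReal.ofReal (c ^ 2) :=
    fun y => (ENNReal.ofReal_sum_of_nonneg fun _ _ => sq_nonneg _).symm.trans
      (congrArg ENNReal.ofReal (hsum y))
  rw [lintegral_congr h3, lintegral_const, ← ofReal_volSph, ← ENNReal.ofReal_mul (by positivity),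
    ← ENNReal.ofReal_natCast, ENNReal.ofReal_eq_ofReal_iff
      (mul_nonneg (by positivity) (volSph_pos d).le) (by positivity)] at h2
  rw [← h2, mul_div_cancel_right₀ _ (volSph_pos d).ne']

theorem norm_evalCLM (x : Sph d) :
    ‖evalCLM 𝕂 k x‖ = Real.sqrt (dimH 𝕂 d k / volSph d) := by
  rw [← norm_evalCLM_sq x, Real.sqrt_sq (ContinuousLinearMap.opNorm_nonneg _)]

theorem norm_contRep_le (u : harmonics 𝕂 d k) (x : Sph d) :
    ‖contRep 𝕂 d k u x‖ ≤ Real.sqrt (dimH 𝕂 d k / volSph d) * ‖u‖ := by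
  rw [← norm_evalCLM x]
  exact (evalCLM 𝕂 k x).le_opNorm u

/-- The Lipschitz constant of the `L^q` norm on `E^k`. -/
def lqConst (d : ℕ) (q : ℝ) (N : ℕ) : ℝ := (N / volSph d : ℝ) ^ (1 / 2 - 1 / q)

/-- Interpolation: `|u|^q ≤ (sup |u|)^(q-2) |u|²`, with the sup bound `norm_contRep_le`. -/
theorem lqNorm_le {q : ℝ} (hq : 2 ≤ q) (u : harmonics 𝕂 d k) :
    lqNorm q u ≤ lqConst d q (dimH 𝕂 d k) * ‖u‖ := by
  have hq0 : 0 < q := by linarith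
  set κ : ℝ := dimH 𝕂 d k / volSph d with hκ
  have hκ0 : 0 ≤ κ := div_nonneg (Nat.cast_nonneg _) (volSph_pos d).le
  set S := Real.sqrt κ * ‖u‖ with hS
  have hS0 : 0 ≤ S := by positivity
  have h1 : ENNReal.ofReal (lqNorm q u ^ q) ≤ ENNReal.ofReal (S ^ (q - 2) * ‖u‖ ^ (2 : ℝ)) := by
    rw [← lintegral_contRep_rpow hq0, ← lqNorm_two u, ENNReal.ofReal_mul (by positivity),
      ← lintegral_contRep_rpow two_pos, ← lintegral_const_mul' _ _ (by simp)]
    refine lintegral_mono fun x => ?_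
    rw [← ENNReal.ofReal_mul (by positivity)]
    refine ENNReal.ofReal_le_ofReal ?_
    have h2 : ‖contRep 𝕂 d k u x‖ ^ q =
        ‖contRep 𝕂 d k u x‖ ^ (q - 2) * ‖contRep 𝕂 d k u x‖ ^ (2 : ℝ) := by
      rw [← Real.rpow_add' (norm_nonneg _) (by linarith)]; congr 1; ring
    rw [h2]
    exact mul_le_mul_of_nonneg_right
      (Real.rpow_le_rpow (norm_nonneg _) (norm_contRep_le u x) (by linarith)) (by positivity)
  rw [ENNReal.ofReal_le_ofReal_iff (by positivity)] at h1
  have hL0 : 0 ≤ lqConst d q (dimH 𝕂 d k) := Real.rpow_nonneg hκ0 _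
  rw [← Real.rpow_le_rpow_iff (lqNorm_nonneg _ _) (by positivity) hq0]
  refine h1.trans (le_of_eq ?_)
  rw [hS, Real.mul_rpow (by positivity) (by positivity), mul_assoc,
    ← Real.rpow_add' (norm_nonneg _) (by linarith), Real.mul_rpow hL0 (norm_nonneg _), lqConst,
    ← hκ, ← Real.rpow_mul hκ0, Real.sqrt_eq_rpow, ← Real.rpow_mul hκ0]
  congr 2
  · field_simp
  · ring

theorem abs_lqNorm_sub_le_mul {q : ℝ} (hq : 2 ≤ q) (u v : harmonics 𝕂 d k) :
    |lqNorm q u - lqNorm q v| ≤ lqConst d q (dimH 𝕂 d k) * ‖u - v‖ :=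
  (abs_lqNorm_sub_le (by linarith) u v).trans (lqNorm_le hq _)

theorem continuous_lqNorm {q : ℝ} (hq : 2 ≤ q) :
    Continuous fun u : harmonics 𝕂 d k => lqNorm q u := by
  refine LipschitzWith.continuous (K := Real.toNNReal (lqConst d q (dimH 𝕂 d k)))
    (LipschitzWith.of_dist_le_mul fun u v => ?_)
  rw [Real.dist_eq, dist_eq_norm]
  exact (abs_lqNorm_sub_le_mul hq u v).trans (by gcongr; exact Real.le_coe_toNNReal _)

theorem lqNorm_mono_exponent {p q : ℝ} (hp : 0 < p) (hpq : p ≤ q) (u : harmonics 𝕂 d k) :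
    lqNorm p u ≤ lqNorm q u * volSph d ^ (1 / p - 1 / q) := by
  have hq : 0 < q := hp.trans_le hpq
  have h0 : 0 ≤ 1 / p - 1 / q := by
    have := one_div_le_one_div_of_le hp hpq
    linarith
  have h := eLpNorm_le_eLpNorm_mul_rpow_measure_univ (μ := surface d)
    (ENNReal.ofReal_le_ofReal hpq) (contRep 𝕂 d k u).continuous.aestronglyMeasurable
  rw [← ofReal_lqNorm, ← ofReal_lqNorm, ENNReal.toReal_ofReal hp.le, ENNReal.toReal_ofReal hq.le,
    ← ofReal_volSph, ENNReal.ofReal_rpow_of_nonneg (volSph_pos d).le h0,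
    ← ENNReal.ofReal_mul (lqNorm_nonneg _ _)] at h
  exact (ENNReal.ofReal_le_ofReal_iff (mul_nonneg (lqNorm_nonneg _ _)
    (Real.rpow_nonneg (volSph_pos d).le _))).mp h

end

end SphHarm

/-! ### Columns of Haar distributed unitary matrices -/

namespace SphHarm

noncomputable section

section Haar

variable (n : ℕ) (𝕂 : Type) [RCLike 𝕂]

instance : (haarU n 𝕂).IsHaarMeasure := by unfold haarU; infer_instance

/-- A right translate of left Haar measure is again a left Haar probability, and that is unique. -/
theorem map_mul_right_haarU (V : UGroup n 𝕂) : (haarU n 𝕂).map (· * V) = haarU n 𝕂 := by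
  have : IsProbabilityMeasure ((haarU n 𝕂).map (· * V)) :=
    Measure.isProbabilityMeasure_map (measurable_mul_const V).aemeasurable
  have : ((haarU n 𝕂).map (· * V)).IsHaarMeasure := Measure.isHaarMeasure_map_mul_right _ V
  exact Measure.isHaarMeasure_eq_of_isProbabilityMeasure _ _

end Haar

section Action

variable {n : ℕ} {𝕂 : Type} [RCLike 𝕂] {E : Type} [NormedAddCommGroup E] [InnerProductSpace 𝕂 E]
  (b : OrthonormalBasis (Fin n) 𝕂 E)

/-- The `l`-th vector of the orthonormal basis obtained from `b` by a unitary matrix. -/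
def colVec (U : UGroup n 𝕂) (l : Fin n) : E := ∑ j, U.1 j l • b j

theorem orthonormal_colVec (U : UGroup n 𝕂) : Orthonormal 𝕂 (colVec b U) := by
  rw [orthonormal_iff_ite]
  intro l m
  have h := congrFun (congrFun (Matrix.UnitaryGroup.star_mul_self U) l) m
  rw [Matrix.mul_apply, Matrix.one_apply] at h
  rw [← h]
  simp only [colVec]
  rw [b.orthonormal.inner_sum]
  simp [Matrix.star_apply]

/-- The rotated orthonormal basis. -/
def rotBasis (U : UGroup n 𝕂) : OrthonormalBasis (Fin n) 𝕂 E :=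
  OrthonormalBasis.mk (orthonormal_colVec b U) <| by
    have hf : FiniteDimensional 𝕂 E := b.toBasis.finiteDimensional_of_finite
    rw [(orthonormal_colVec b U).linearIndependent.span_eq_top_of_card_eq_finrank']
    simp [Module.finrank_eq_card_basis b.toBasis]

@[simp]
theorem rotBasis_apply (U : UGroup n 𝕂) (l : Fin n) : rotBasis b U l = colVec b U l := by
  simp [rotBasis]

/-- The unitary group acting on `E` through the basis `b`. -/
def unitaryAct (U : UGroup n 𝕂) : E ≃ₗᵢ[𝕂] E := b.equiv (rotBasis b U) (Equiv.refl _)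

theorem unitaryAct_apply (U : UGroup n 𝕂) (x : E) :
    unitaryAct b U x = ∑ j, b.repr x j • colVec b U j := by
  simp [unitaryAct, OrthonormalBasis.equiv_apply]

theorem unitaryAct_colVec (U V : UGroup n 𝕂) (l : Fin n) :
    unitaryAct b U (colVec b V l) = colVec b (U * V) l := by
  have h : ∀ j, unitaryAct b U (b j) = colVec b U j := fun j => by
    simp [unitaryAct, OrthonormalBasis.equiv_apply_basis]
  rw [colVec, map_sum]
  simp_rw [map_smul, h, colVec, Finset.smul_sum, smul_smul]
  rw [Finset.sum_comm]
  refine Finset.sum_congr rfl fun i _ => ?_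
  rw [← Finset.sum_smul]
  congr 1
  rw [show (U * V).1 i l = (U.1 * V.1) i l from rfl, Matrix.mul_apply]
  exact Finset.sum_congr rfl fun j _ => mul_comm _ _

/-- Transitivity on the sphere: extend `x`, in position `l`, to an orthonormal basis and take the
change-of-basis matrix. -/
theorem exists_colVec_eq {x : E} (hx : ‖x‖ = 1) (l : Fin n) : ∃ V : UGroup n 𝕂, colVec b V l = x := by
  have hf : FiniteDimensional 𝕂 E := b.toBasis.finiteDimensional_of_finite
  have ho : Orthonormal 𝕂 (({l} : Set (Fin n)).domRestrict fun _ => x) := by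
    refine ⟨fun i => hx, fun i j hij => absurd (Subsingleton.elim i j) hij⟩
  obtain ⟨b', hb'⟩ := ho.exists_orthonormalBasis_extension_of_card_eq
    (by rw [Module.finrank_eq_card_basis b.toBasis])
  refine ⟨⟨b.toBasis.toMatrix b', b.toMatrix_orthonormalBasis_mem_unitary b'⟩, ?_⟩
  rw [← hb' l rfl]
  have := b.toBasis.sum_toMatrix_smul_self b' l
  simpa [colVec] using this

variable [NormedSpace ℝ E] [IsScalarTower ℝ 𝕂 E]

/-- A `𝕂`-linear isometry as a real isometry. -/
def realIsometry (T : E ≃ₗᵢ[𝕂] E) : E ≃ₗᵢ[ℝ] E :=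
  { T.toLinearEquiv.restrictScalars ℝ with norm_map' := T.norm_map }

@[simp]
theorem realIsometry_apply (T : E ≃ₗᵢ[𝕂] E) (x : E) : realIsometry T x = T x := rfl

/-- The column of a unitary matrix as a point of the unit sphere. -/
def colSphere (l : Fin n) (U : UGroup n 𝕂) : Metric.sphere (0 : E) 1 :=
  ⟨colVec b U l, by simpa using (orthonormal_colVec b U).1 l⟩

omit [NormedSpace ℝ E] [IsScalarTower ℝ 𝕂 E] in
theorem continuous_colVec (l : Fin n) : Continuous fun U : UGroup n 𝕂 => colVec b U l := by
  unfold colVec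
  refine continuous_finsetSum _ fun j _ => Continuous.smul ?_ continuous_const
  exact (continuous_apply_apply (ρ := fun _ _ => 𝕂) j l).comp continuous_subtype_val

omit [NormedSpace ℝ E] [IsScalarTower ℝ 𝕂 E] in
theorem continuous_colSphere (l : Fin n) : Continuous (colSphere b l) :=
  (continuous_colVec b l).subtype_mk _

variable [FiniteDimensional ℝ E] [MeasurableSpace E] [BorelSpace E]

/-- A column of a Haar distributed unitary matrix is uniform on the sphere. -/
theorem map_colSphere_haarU [Nontrivial E] (l : Fin n) :
    (haarU n 𝕂).map (colSphere b l) = uniformSphere E := by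
  let σ := uniformSphere E
  let act : UGroup n 𝕂 → Metric.sphere (0 : E) 1 → Metric.sphere (0 : E) 1 := fun U =>
    sphereMap (realIsometry (unitaryAct b U))
  have hcont : Continuous fun p : UGroup n 𝕂 × Metric.sphere (0 : E) 1 => act p.1 p.2 := by
    refine Continuous.subtype_mk ?_ _
    simp only [realIsometry_apply, unitaryAct_apply]
    refine continuous_finsetSum _ fun j _ => Continuous.smul ?_ ?_
    · have h : Continuous fun x : E => b.repr x j := by
        simp_rw [b.repr_apply_apply]
        fun_prop
      exact h.comp (continuous_subtype_val.comp continuous_snd)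
    · exact (continuous_colVec b j).comp continuous_fst
  ext s hs
  rw [Measure.map_apply (continuous_colSphere b l).measurable hs]
  have hS : MeasurableSet {p : UGroup n 𝕂 × Metric.sphere (0 : E) 1 | act p.1 p.2 ∈ s} :=
    hcont.measurable hs
  -- Measure the pairs `(U, x)` with `U x ∈ s` in both orders. For fixed `U`, invariance of the
  -- sphere gives `σ s`; for fixed `x`, the `l`-th column of some `V`, right invariance of Haar
  -- measure gives the law of the `l`-th column.
  have h1 := Measure.prod_apply (μ := haarU n 𝕂) (ν := σ) hS
  have h2 := Measure.prod_apply_symm (μ := haarU n 𝕂) (ν := σ) hS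
  have e1 : ∀ U, σ (Prod.mk U ⁻¹' {p : UGroup n 𝕂 × Metric.sphere (0 : E) 1 | act p.1 p.2 ∈ s}) =
      σ s := fun U =>
    (measurePreserving_sphereMap (realIsometry (unitaryAct b U))).measure_preimage
      hs.nullMeasurableSet
  have e2 : ∀ x, haarU n 𝕂 ((fun U => (U, x)) ⁻¹'
      {p : UGroup n 𝕂 × Metric.sphere (0 : E) 1 | act p.1 p.2 ∈ s}) =
      haarU n 𝕂 (colSphere b l ⁻¹' s) := by
    intro x
    obtain ⟨V, hV⟩ := exists_colVec_eq b (mem_sphere_zero_iff_norm.mp x.2) l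
    have : (fun U => (U, x)) ⁻¹' {p : UGroup n 𝕂 × Metric.sphere (0 : E) 1 | act p.1 p.2 ∈ s} =
        (· * V) ⁻¹' (colSphere b l ⁻¹' s) := by
      ext U
      have hx : act U x = colSphere b l (U * V) := by
        refine Subtype.ext ?_
        show unitaryAct b U x = colVec b (U * V) l
        rw [← hV, unitaryAct_colVec]
      show act U x ∈ s ↔ colSphere b l (U * V) ∈ s
      rw [hx]
    rw [this, ← Measure.map_apply (measurable_mul_const V)
      ((continuous_colSphere b l).measurable hs), map_mul_right_haarU]
  simp only [e1, lintegral_const, measure_univ, mul_one] at h1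
  simp only [e2, lintegral_const, measure_univ, mul_one] at h2
  rw [← h2, h1]

end Action

section Basis

variable {𝕂 : Type} [RCLike 𝕂] {d : ℕ}

theorem nontrivial_harmonics (hd : 2 ≤ d) (k : ℕ) : Nontrivial (harmonics 𝕂 d k) :=
  Module.nontrivial_of_finrank_pos (R := 𝕂) ((Nat.zero_le k).trans_lt (lt_dimH 𝕂 k hd))

/-- Each element of a random basis is uniform on the unit sphere of `E^k`. -/
theorem basisLaw_basisElt (hd : 2 ≤ d) (e : RefBasis 𝕂 d) (k : ℕ) (l : Fin (dimH 𝕂 d k))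
    {p : harmonics 𝕂 d k → Prop} (hp : MeasurableSet {u | p u}) :
    basisLaw 𝕂 d {B | p (basisElt e B k l)} = uniformSphere (harmonics 𝕂 d k) {u | p u} := by
  have := nontrivial_harmonics (𝕂 := 𝕂) hd k
  have hs : MeasurableSet {u : Metric.sphere (0 : harmonics 𝕂 d k) 1 | p u} :=
    measurable_subtype_coe hp
  rw [← map_colSphere_haarU (e k) l, Measure.map_apply (continuous_colSphere (e k) l).measurable hs,
    ← (measurePreserving_eval_infinitePi (fun k => haarU (dimH 𝕂 d k) 𝕂) k).measure_preimage
      ((continuous_colSphere (e k) l).measurable hs).nullMeasurableSet]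
  rfl

end Basis

end

end SphHarm

/-! ### Concentration and moments of the `L^q` norm -/

namespace SphHarm

noncomputable section

section Generic

variable {𝕂 : Type} [RCLike 𝕂] {d k : ℕ}

/-- The only Euclidean input of the concentration estimates, stated without scalars so that real and
complex harmonics are treated alike as real normed spaces. -/
theorem parallelogram_harmonics (u v : harmonics 𝕂 d k) :
    ‖u + v‖ ^ 2 + ‖u - v‖ ^ 2 ≤ 2 * (‖u‖ ^ 2 + ‖v‖ ^ 2) := by
  have := parallelogram_law_with_norm 𝕂 u v
  nlinarith

theorem dimH_le_finrank_real : dimH 𝕂 d k ≤ Module.finrank ℝ (harmonics 𝕂 d k) := by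
  rw [dimH, ← Module.finrank_mul_finrank ℝ 𝕂 (harmonics 𝕂 d k)]
  exact Nat.le_mul_of_pos_left _ Module.finrank_pos

/-- The right side equals `N^(2/q) * Vol^(1 - 2/q)`, and the exponent of `Vol` lies in `[0, 1]`. The
factor `min 1 Vol` is what makes the final rate independent of `q`. -/
theorem le_div_lqConst_sq {N : ℕ} (hN : 0 < N) {q : ℝ} (hq : 2 ≤ q) :
    min 1 (volSph d) * (N : ℝ) ^ (2 / q) ≤ N / lqConst d q N ^ 2 := by
  have hV := volSph_pos d
  have hN' : (0 : ℝ) < N := by exact_mod_cast hN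
  have hq0 : 0 < q := by linarith
  have h2q : 2 / q ≤ 1 := (div_le_one hq0).mpr hq
  have h2q0 : 0 < 2 / q := by positivity
  have h1 : lqConst d q N ^ 2 = (N : ℝ) ^ (1 - 2 / q) / volSph d ^ (1 - 2 / q) := by
    rw [lqConst, ← Real.rpow_two, ← Real.rpow_mul (by positivity), ← Real.div_rpow hN'.le hV.le]
    congr 1
    ring
  have h2 : min 1 (volSph d) ≤ volSph d ^ (1 - 2 / q) := by
    rcases le_total 1 (volSph d) with h | h
    · rw [min_eq_left h]
      exact Real.one_le_rpow h (by linarith)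
    · rw [min_eq_right h]
      calc volSph d = volSph d ^ (1 : ℝ) := (Real.rpow_one _).symm
        _ ≤ _ := Real.rpow_le_rpow_of_exponent_ge hV h (by linarith)
  have h3 : (N : ℝ) = (N : ℝ) ^ (2 / q) * (N : ℝ) ^ (1 - 2 / q) := by
    rw [← Real.rpow_add hN']; simp
  rw [h1, div_div_eq_mul_div, le_div_iff₀ (by positivity)]
  calc min 1 (volSph d) * (N : ℝ) ^ (2 / q) * (N : ℝ) ^ (1 - 2 / q)
      = min 1 (volSph d) * ((N : ℝ) ^ (2 / q) * (N : ℝ) ^ (1 - 2 / q)) := by ring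
    _ = N * min 1 (volSph d) := by rw [← h3, mul_comm]
    _ ≤ _ := by gcongr

/-- The rate of concentration of the `L^q` norm on a space of dimension `N`. -/
def concRate (d : ℕ) (q : ℝ) (N : ℕ) : ℝ := min 1 (volSph d) / 64 * (N : ℝ) ^ (2 / q)

theorem concRate_pos {N : ℕ} (hN : 0 < N) (q : ℝ) : 0 < concRate d q N := by
  have := volSph_pos d
  have hN' : (0 : ℝ) < N := by exact_mod_cast hN
  unfold concRate
  positivity

/-- Concentration of the `L^q` norm of spherical harmonics around its median. -/
theorem uniformSphere_lqNorm_sub_median_le (hd : 2 ≤ d) {q : ℝ} (hq : 2 ≤ q) {M : ℝ}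
    (hM : IsLqMedian 𝕂 d k q M) {r : ℝ} (hr : 0 ≤ r) :
    uniformSphere (harmonics 𝕂 d k) {u | r < |lqNorm q u.1 - M|} ≤
      ENNReal.ofReal (16 * Real.exp (-(concRate d q (dimH 𝕂 d k) * r ^ 2))) := by
  have := nontrivial_harmonics (𝕂 := 𝕂) hd k
  have hN : 0 < dimH 𝕂 d k := (Nat.zero_le k).trans_lt (lt_dimH 𝕂 k hd)
  have hN' : (0 : ℝ) < dimH 𝕂 d k := by exact_mod_cast hN
  have hV := volSph_pos d
  have hL : 0 < lqConst d q (dimH 𝕂 d k) := Real.rpow_pos_of_pos (by positivity) _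
  refine (uniformSphere_abs_sub_median_le parallelogram_harmonics
    (F := fun u => lqNorm q u.1)
    ((continuous_lqNorm hq).comp continuous_subtype_val).measurable hL
    (fun u v => abs_lqNorm_sub_le_mul hq u.1 v.1) hM hr).trans (ENNReal.ofReal_le_ofReal ?_)
  gcongr
  have h1 := le_div_lqConst_sq (d := d) hN hq
  have h2 : (dimH 𝕂 d k : ℝ) ≤ Module.finrank ℝ (harmonics 𝕂 d k) := by
    exact_mod_cast dimH_le_finrank_real
  calc concRate d q (dimH 𝕂 d k) * r ^ 2
      = min 1 (volSph d) * (dimH 𝕂 d k : ℝ) ^ (2 / q) * (r ^ 2 / 64) := by rw [concRate]; ring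
    _ ≤ dimH 𝕂 d k / lqConst d q (dimH 𝕂 d k) ^ 2 * (r ^ 2 / 64) := by gcongr
    _ = dimH 𝕂 d k * (r / lqConst d q (dimH 𝕂 d k)) ^ 2 / 64 := by ring
    _ ≤ _ := by gcongr

theorem lintegral_lqNorm_rpow (hd : 2 ≤ d) {q : ℝ} (hq : 0 < q) :
    ∫⁻ u, ENNReal.ofReal (lqNorm q u.1 ^ q) ∂uniformSphere (harmonics 𝕂 d k) =
      ∫⁻ x, ∫⁻ u, ENNReal.ofReal (‖contRep 𝕂 d k u x‖ ^ q) ∂uniformSphere (harmonics 𝕂 d k)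
        ∂surface d := by
  have := nontrivial_harmonics (𝕂 := 𝕂) hd k
  simp_rw [← lintegral_contRep_rpow hq]
  refine lintegral_lintegral_swap (Measurable.aemeasurable ?_)
  have hc : Continuous (contRep 𝕂 d k) := LinearMap.continuous_of_finiteDimensional _
  have h : Continuous fun p : Metric.sphere (0 : harmonics 𝕂 d k) 1 × Sph d =>
      contRep 𝕂 d k p.1 p.2 :=
    ContinuousEval.continuous_eval.comp
      ((hc.comp (continuous_subtype_val.comp continuous_fst)).prodMk continuous_snd)
  exact (h.norm.measurable.pow_const q).ennreal_ofReal

theorem norm_le_abs_re_add_abs_im (z : 𝕂) : ‖z‖ ≤ |RCLike.re z| + |RCLike.im z| := by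
  refine abs_le_of_sq_le_sq' ?_ (by positivity) |>.2
  rw [RCLike.norm_sq_eq_def, add_sq, sq_abs, sq_abs]
  nlinarith [mul_nonneg (abs_nonneg (RCLike.re z)) (abs_nonneg (RCLike.im z))]

theorem measure_le_of_subset_union {Ω : Type} [MeasurableSpace Ω] {P : Measure Ω} {A B C : Set Ω}
    (h : C ⊆ A ∪ B) {c₁ c₂ : ℝ≥0∞} (hA : P A ≤ c₁) (hB : P B ≤ c₂) : P C ≤ c₁ + c₂ :=
  (measure_mono h).trans ((measure_union_le _ _).trans (add_le_add hA hB))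

/-- The squared evaluation norm `N_k / Vol` cancels the dimension in the concentration exponent, so
the tail depends neither on `k` nor on `x`. The functional `f` stands for the real or the imaginary
part. -/
theorem uniformSphere_linear_contRep_le (hd : 2 ≤ d) (x : Sph d) {t : ℝ} (ht : 0 ≤ t)
    (f : 𝕂 →ₗ[ℝ] ℝ) (hf : ∀ z, |f z| ≤ ‖z‖) :
    uniformSphere (harmonics 𝕂 d k) {u | t < |f (contRep 𝕂 d k u x)|} ≤
      ENNReal.ofReal (16 * Real.exp (-(volSph d / 64 * t ^ 2))) := by
  have := nontrivial_harmonics (𝕂 := 𝕂) hd k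
  have hN' : (0 : ℝ) < dimH 𝕂 d k := by
    exact_mod_cast (Nat.zero_le k).trans_lt (lt_dimH 𝕂 k hd)
  have hV := volSph_pos d
  set κ : ℝ := dimH 𝕂 d k / volSph d with hκ
  have hκ0 : 0 < κ := by positivity
  refine (uniformSphere_abs_linear_le parallelogram_harmonics
    (f ∘ₗ (evalCLM 𝕂 k x).toLinearMap.restrictScalars ℝ) (Real.sqrt_pos.mpr hκ0)
    (fun u => (hf _).trans (norm_contRep_le u x)) ht).trans (ENNReal.ofReal_le_ofReal ?_)
  gcongr
  have h2 : (dimH 𝕂 d k : ℝ) ≤ Module.finrank ℝ (harmonics 𝕂 d k) := by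
    exact_mod_cast dimH_le_finrank_real
  calc volSph d / 64 * t ^ 2 = dimH 𝕂 d k * (t / Real.sqrt κ) ^ 2 / 64 := by
        rw [div_pow, Real.sq_sqrt hκ0.le, hκ]; field_simp
    _ ≤ _ := by gcongr

/-- Values of random spherical harmonics have Gaussian tails. -/
theorem uniformSphere_contRep_le (hd : 2 ≤ d) (x : Sph d) {t : ℝ} (ht : 0 ≤ t) :
    uniformSphere (harmonics 𝕂 d k) {u | t < ‖contRep 𝕂 d k u x‖} ≤
      ENNReal.ofReal (32 * Real.exp (-(volSph d / 256 * t ^ 2))) := by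
  -- If `‖z‖ > t`, the real or the imaginary part exceeds `t / 2`; halving `t` turns `64` into
  -- `256`.
  have h1 := uniformSphere_linear_contRep_le (k := k) hd x (by positivity : 0 ≤ t / 2)
    (RCLike.reLm : 𝕂 →ₗ[ℝ] ℝ) fun z => RCLike.abs_re_le_norm z
  have h2 := uniformSphere_linear_contRep_le (k := k) hd x (by positivity : 0 ≤ t / 2)
    (RCLike.imLm : 𝕂 →ₗ[ℝ] ℝ) fun z => RCLike.abs_im_le_norm z
  rw [show volSph d / 64 * (t / 2) ^ 2 = volSph d / 256 * t ^ 2 by ring] at h1 h2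
  have h3 : ∀ c : ℝ, 0 ≤ c → ENNReal.ofReal (16 * c) + ENNReal.ofReal (16 * c) =
      ENNReal.ofReal (32 * c) := fun c hc => by
    rw [← ENNReal.ofReal_add (by positivity) (by positivity)]; congr 1; ring
  rw [← h3 _ (Real.exp_nonneg _)]
  refine measure_le_of_subset_union ?_ h1 h2
  intro u (hu : t < ‖contRep 𝕂 d k u x‖)
  rw [Set.mem_union]
  by_contra hcon
  obtain ⟨hc1, hc2⟩ := not_or.mp hcon
  have hc1 : |RCLike.re (contRep 𝕂 d k u x)| ≤ t / 2 := not_lt.mp hc1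
  have hc2 : |RCLike.im (contRep 𝕂 d k u x)| ≤ t / 2 := not_lt.mp hc2
  have := norm_le_abs_re_add_abs_im (contRep 𝕂 d k u x)
  linarith

/-- The medians of the `L^q` norm are bounded in the degree. -/
theorem exists_median_le (hd : 2 ≤ d) {q : ℝ} (hq : 2 ≤ q) :
    ∃ K : ℝ, ∀ (k : ℕ) (M : ℝ), IsLqMedian 𝕂 d k q M → M ≤ K := by
  have hV := volSph_pos d
  have hq0 : 0 < q := by linarith
  -- The moment bound `lintegral_rpow_le_of_tail` with the tail constants `32` and `Vol / 256` of
  -- `uniformSphere_contRep_le`.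
  set b := (2 * 32 * Real.sqrt q / Real.sqrt (volSph d / 256)) with hb
  have hb0 : 0 ≤ b := by positivity
  refine ⟨(2 * (b ^ q * volSph d)) ^ (1 / q), fun k M hM => ?_⟩
  rcases lt_or_ge M 0 with hM0 | hM0
  · exact hM0.le.trans (by positivity)
  have h1 : ∫⁻ u, ENNReal.ofReal (lqNorm q u.1 ^ q) ∂uniformSphere (harmonics 𝕂 d k) ≤
      ENNReal.ofReal (b ^ q * volSph d) := by
    rw [lintegral_lqNorm_rpow hd hq0]
    calc _ ≤ ∫⁻ _, ENNReal.ofReal (b ^ q) ∂surface d := by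
          refine lintegral_mono fun x => ?_
          refine lintegral_rpow_le_of_tail _ ?_ (fun u => norm_nonneg _) (by norm_num)
            (by positivity) (by linarith) fun t ht => uniformSphere_contRep_le hd x ht
          exact ((evalCLM 𝕂 k x).continuous.comp continuous_subtype_val).norm.measurable
      _ = _ := by
          rw [lintegral_const, ← ofReal_volSph, ← ENNReal.ofReal_mul (by positivity)]
  have hF : Measurable fun u : Metric.sphere (0 : harmonics 𝕂 d k) 1 =>
      ENNReal.ofReal (lqNorm q u.1 ^ q) :=
    (((continuous_lqNorm hq).comp continuous_subtype_val).measurable.pow_const q).ennreal_ofReal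
  -- Markov's inequality at the level `M ^ q`, which is reached with probability at least `1/2`.
  have h2 := mul_meas_ge_le_lintegral (μ := uniformSphere (harmonics 𝕂 d k)) hF
    (ENNReal.ofReal (M ^ q))
  have h3 : (1 / 2 : ℝ≥0∞) ≤ uniformSphere (harmonics 𝕂 d k)
      {u | ENNReal.ofReal (M ^ q) ≤ ENNReal.ofReal (lqNorm q u.1 ^ q)} := by
    refine hM.1.trans (measure_mono fun u (hu : M ≤ lqNorm q u.1) => ?_)
    exact ENNReal.ofReal_le_ofReal (Real.rpow_le_rpow hM0 hu hq0.le)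
  have h4 : ENNReal.ofReal (M ^ q) ≤ ENNReal.ofReal (2 * (b ^ q * volSph d)) := by
    calc ENNReal.ofReal (M ^ q) = 2 * (ENNReal.ofReal (M ^ q) * (1 / 2)) := by
          rw [mul_left_comm, one_div, ENNReal.mul_inv_cancel two_ne_zero (by simp), mul_one]
      _ ≤ 2 * ENNReal.ofReal (b ^ q * volSph d) := by
          gcongr
          exact (mul_le_mul' le_rfl h3).trans (h2.trans h1)
      _ = _ := by rw [ENNReal.ofReal_mul zero_le_two, ENNReal.ofReal_ofNat]
  rw [ENNReal.ofReal_le_ofReal_iff (by positivity)] at h4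
  calc M = (M ^ q) ^ (1 / q) := by rw [← Real.rpow_mul hM0, mul_one_div_cancel hq0.ne', Real.rpow_one]
    _ ≤ _ := by gcongr

end Generic

end

end SphHarm

/-! ### Moments of coordinates on complex spheres -/

namespace SphHarm

noncomputable section

section Polar

variable {E : Type} [NormedAddCommGroup E] [NormedSpace ℝ E] [FiniteDimensional ℝ E]
  [MeasurableSpace E] [BorelSpace E] [Nontrivial E]

theorem lintegral_volumeIoiPow_gaussian {n : ℕ} (hn : 0 < n) {q : ℝ} (hq : 0 ≤ q) :
    ∫⁻ r : Set.Ioi (0 : ℝ), ENNReal.ofReal (r.1 ^ q * Real.exp (-r.1 ^ (2 : ℝ)))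
      ∂Measure.volumeIoiPow (n - 1) = ENNReal.ofReal (Real.Gamma ((q + n) / 2) / 2) := by
  have hn1 : (1 : ℝ) ≤ n := by exact_mod_cast hn
  rw [Measure.volumeIoiPow, lintegral_withDensity_eq_lintegral_mul _ (by fun_prop) (by fun_prop)]
  simp only [Pi.mul_apply]
  rw [lintegral_subtype_comap measurableSet_Ioi (fun r : ℝ => ENNReal.ofReal (r ^ (n - 1)) *
    ENNReal.ofReal (r ^ q * Real.exp (-r ^ (2 : ℝ))))]
  have hI := integral_rpow_mul_exp_neg_rpow (p := 2) (q := q + n - 1) two_pos (by linarith)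
  rw [show 1 / 2 * Real.Gamma ((q + n - 1 + 1) / 2) = Real.Gamma ((q + n) / 2) / 2 by
    rw [sub_add_cancel]; ring] at hI
  rw [← hI, ofReal_integral_eq_lintegral_ofReal]
  · refine setLIntegral_congr_fun measurableSet_Ioi fun r hr => ?_
    have hr0 : (0 : ℝ) < r := hr
    rw [← ENNReal.ofReal_mul (by positivity), ← mul_assoc, ← Real.rpow_natCast, ← Real.rpow_add hr0,
      Nat.cast_sub hn]
    congr 3
    push_cast
    ring
  · exact integrableOn_rpow_mul_exp_neg_rpow (by linarith) (by norm_num)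
  · filter_upwards [ae_restrict_mem measurableSet_Ioi] with r hr
    have hr0 : (0 : ℝ) < r := hr
    show 0 ≤ r ^ (q + n - 1) * Real.exp (-r ^ (2 : ℝ))
    positivity

/-- Gaussian integral of a homogeneous function in polar coordinates. -/
theorem lintegral_homogeneous_gaussian (μ : Measure E) [μ.IsAddHaarMeasure] {f : E → ℝ}
    (hf : Measurable f) (hf0 : 0 ≤ f) {q : ℝ} (hq : 0 ≤ q)
    (hom : ∀ r : ℝ, 0 < r → ∀ x, f (r • x) = r ^ q * f x) :
    ∫⁻ x, ENNReal.ofReal (f x * Real.exp (-‖x‖ ^ (2 : ℝ))) ∂μ =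
      (∫⁻ u, ENNReal.ofReal (f u) ∂μ.toSphere) *
        ENNReal.ofReal (Real.Gamma ((q + Module.finrank ℝ E) / 2) / 2) := by
  have hg1 : Measurable fun u : Metric.sphere (0 : E) 1 => ENNReal.ofReal (f u) :=
    (hf.comp measurable_subtype_coe).ennreal_ofReal
  have hg2 : Measurable fun r : Set.Ioi (0 : ℝ) =>
      ENNReal.ofReal (r.1 ^ q * Real.exp (-r.1 ^ (2 : ℝ))) := by fun_prop
  rw [← lintegral_volumeIoiPow_gaussian Module.finrank_pos hq,
    ← lintegral_prod_mul hg1.aemeasurable hg2.aemeasurable,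
    ← μ.measurePreserving_homeomorphUnitSphereProd.lintegral_comp_emb
      (Homeomorph.measurableEmbedding _)]
  conv_lhs => rw [← restrict_compl_singleton (μ := μ) 0]
  rw [← lintegral_subtype_comap (measurableSet_singleton _).compl]
  refine lintegral_congr fun x => ?_
  have hx : (x : E) ≠ 0 := x.2
  have hx0 : 0 < ‖(x : E)‖ := norm_pos_iff.mpr hx
  rw [homeomorphUnitSphereProd_apply_fst_coe, homeomorphUnitSphereProd_apply_snd_coe,
    ← ENNReal.ofReal_mul (hf0 _)]
  congr 1
  have := hom ‖(x : E)‖ hx0 (‖(x : E)‖⁻¹ • (x : E))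
  rw [smul_inv_smul₀ hx0.ne'] at this
  rw [this]
  ring

end Polar

/-! ### Gaussian integrals in complex coordinates -/

section Complex

theorem lintegral_complex_gaussian {q : ℝ} (hq : 0 ≤ q) :
    ∫⁻ z : ℂ, ENNReal.ofReal (‖z‖ ^ q * Real.exp (-‖z‖ ^ (2 : ℝ))) =
      ENNReal.ofReal (Real.pi * Real.Gamma (q / 2 + 1)) := by
  have hI := Complex.integral_rpow_mul_exp_neg_rpow (p := 2) (q := q) (by norm_num) (by linarith)
  rw [show 2 * Real.pi / 2 * Real.Gamma ((q + 2) / 2) = Real.pi * Real.Gamma (q / 2 + 1) by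
    rw [mul_div_cancel_left₀ _ two_ne_zero]; congr 2; ring] at hI
  have hpos : 0 < Real.pi * Real.Gamma (q / 2 + 1) :=
    mul_pos Real.pi_pos (Real.Gamma_pos_of_pos (by positivity))
  rw [← hI, ofReal_integral_eq_lintegral_ofReal]
  -- A non-integrable function would have Bochner integral `0`, contradicting the positive closed
  -- form.
  · by_contra hcon
    rw [integral_undef hcon] at hI
    exact hpos.ne hI
  · exact .of_forall fun z => by positivity

variable {E : Type} [NormedAddCommGroup E] [InnerProductSpace ℂ E] [NormedSpace ℝ E]
  [IsScalarTower ℝ ℂ E] [FiniteDimensional ℝ E] [MeasurableSpace E] [BorelSpace E]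

/-- In orthonormal coordinates the Gaussian is a product, and the weight touches only one complex
factor. Comparing with exponent `0` leaves the Haar constant and the other factors on both sides, so
they need not be computed. -/
theorem lintegral_coordinate_gaussian (μ : Measure E) [μ.IsAddHaarMeasure] {m : ℕ}
    (b : OrthonormalBasis (Fin (m + 1)) ℂ E) {q : ℝ} (hq : 0 ≤ q) :
    ∫⁻ x, ENNReal.ofReal (‖inner ℂ (b 0) x‖ ^ q * Real.exp (-‖x‖ ^ (2 : ℝ))) ∂μ =
      ENNReal.ofReal (Real.Gamma (q / 2 + 1)) * ∫⁻ x, ENNReal.ofReal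
        (‖inner ℂ (b 0) x‖ ^ (0 : ℝ) * Real.exp (-‖x‖ ^ (2 : ℝ))) ∂μ := by
  let g : E ≃L[ℝ] (Fin (m + 1) → ℂ) :=
    ((b.repr.toLinearEquiv.trans (WithLp.linearEquiv 2 ℂ (Fin (m + 1) → ℂ))).restrictScalars
      ℝ).toContinuousLinearEquiv
  have hg : ∀ x i, g x i = inner ℂ (b i) x := fun x i => b.repr_apply_apply x i
  have hH : (μ.map g).IsAddHaarMeasure := g.isAddHaarMeasure_map μ
  obtain ⟨c, hc⟩ : ∃ c : ℝ≥0∞, μ.map g = c • volume :=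
    ⟨_, Measure.isAddLeftInvariant_eq_smul (μ.map g) volume⟩
  let e := (MeasurableEquiv.piFinSuccAbove (fun _ : Fin (m + 1) => ℂ) 0).symm
  let R : ℝ≥0∞ := ∫⁻ y : Fin m → ℂ, ENNReal.ofReal (Real.exp (-∑ i, ‖y i‖ ^ 2))
  have key : ∀ p : ℝ, 0 ≤ p →
      ∫⁻ x, ENNReal.ofReal (‖inner ℂ (b 0) x‖ ^ p * Real.exp (-‖x‖ ^ (2 : ℝ))) ∂μ =
        c * (ENNReal.ofReal (Real.pi * Real.Gamma (p / 2 + 1)) * R) := by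
    intro p hp
    let F : (Fin (m + 1) → ℂ) → ℝ≥0∞ := fun z =>
      ENNReal.ofReal (‖z 0‖ ^ p * Real.exp (-∑ i, ‖z i‖ ^ 2))
    have hF : Measurable F := by fun_prop
    have h1 : ∀ x, ENNReal.ofReal (‖inner ℂ (b 0) x‖ ^ p * Real.exp (-‖x‖ ^ (2 : ℝ))) = F (g x) := by
      intro x
      simp only [F, hg]
      rw [b.sum_sq_norm_inner_right, Real.rpow_two]
    rw [lintegral_congr h1, ← lintegral_map hF g.continuous.measurable, hc, lintegral_smul_measure,
      smul_eq_mul]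
    congr 1
    rw [← (volume_preserving_piFinSuccAbove (fun _ : Fin (m + 1) => ℂ) 0).symm.lintegral_comp hF,
      ← lintegral_complex_gaussian hp]
    have hR : Measurable fun y : Fin m → ℂ => ENNReal.ofReal (Real.exp (-∑ i, ‖y i‖ ^ 2)) := by
      fun_prop
    rw [← lintegral_prod_mul (by fun_prop) hR.aemeasurable]
    refine lintegral_congr fun z => ?_
    have e0 : e z 0 = z.1 := rfl
    have es : ∀ i : Fin m, e z i.succ = z.2 i := fun i => rfl
    show F (e z) = _
    simp only [F]
    rw [Fin.sum_univ_succ, e0, ← ENNReal.ofReal_mul (by positivity)]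
    simp_rw [es]
    rw [neg_add, Real.exp_add, Real.rpow_two, mul_assoc]
  rw [key q hq, key 0 le_rfl, ENNReal.ofReal_mul Real.pi_pos.le, zero_div, zero_add, Real.Gamma_one,
    mul_one]
  ring

/-- The moments of a coordinate of a uniform point of a complex sphere. -/
theorem lintegral_norm_inner_rpow {N : ℕ} (hN : Module.finrank ℂ E = N) (hN0 : 0 < N) {w : E}
    (hw : ‖w‖ = 1) {q : ℝ} (hq : 0 ≤ q) :
    ∫⁻ u, ENNReal.ofReal (‖inner ℂ w (u : E)‖ ^ q) ∂uniformSphere E =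
      ENNReal.ofReal (Real.Gamma (q / 2 + 1) * Real.Gamma N / Real.Gamma (q / 2 + N)) := by
  obtain ⟨m, rfl⟩ : ∃ m, N = m + 1 := ⟨N - 1, by omega⟩
  have hfin : FiniteDimensional ℂ E := FiniteDimensional.of_finrank_pos (by omega)
  have hnt : Nontrivial E := Module.nontrivial_of_finrank_pos (R := ℂ) (by omega)
  have ho : Orthonormal ℂ (({0} : Set (Fin (m + 1))).domRestrict fun _ => w) :=
    ⟨fun i => hw, fun i j hij => absurd (Subsingleton.elim i j) hij⟩
  obtain ⟨b, hb⟩ := ho.exists_orthonormalBasis_extension_of_card_eq (by simpa using hN)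
  have hb0 : b 0 = w := hb 0 rfl
  set μ : Measure E := Measure.addHaar
  have hdim : (Module.finrank ℝ E : ℝ) = 2 * (m + 1 : ℕ) := by
    rw [← Module.finrank_mul_finrank ℝ ℂ E, hN, Complex.finrank_real_complex]
    push_cast; ring
  -- The same Gaussian integral in polar coordinates; using it for `p = q` and `p = 0` yields the
  -- ratio of sphere integrals as a ratio of Gamma values.
  have hpol : ∀ p : ℝ, 0 ≤ p →
      ∫⁻ x, ENNReal.ofReal (‖inner ℂ (b 0) x‖ ^ p * Real.exp (-‖x‖ ^ (2 : ℝ))) ∂μ =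
        (∫⁻ u, ENNReal.ofReal (‖inner ℂ w (u : E)‖ ^ p) ∂μ.toSphere) *
          ENNReal.ofReal (Real.Gamma (p / 2 + (m + 1 : ℕ)) / 2) := by
    intro p hp
    rw [hb0, lintegral_homogeneous_gaussian μ (f := fun x => ‖inner ℂ w x‖ ^ p)
      (by fun_prop) (fun x => by positivity) hp, hdim]
    · congr 4
      ring
    · intro r hr x
      rw [← algebraMap_smul ℂ r x, inner_smul_right, norm_mul,
        Real.mul_rpow (norm_nonneg _) (norm_nonneg _)]
      simp [abs_of_pos hr]
  have h := lintegral_coordinate_gaussian μ b hq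
  rw [hpol q hq, hpol 0 le_rfl] at h
  simp only [Real.rpow_zero, ENNReal.ofReal_one, lintegral_const, one_mul, zero_div, zero_add] at h
  set S := μ.toSphere Set.univ
  have hS0 : S ≠ 0 := Measure.measure_univ_ne_zero.mpr (Measure.toSphere_ne_zero _)
  have hSt : S ≠ ⊤ := measure_ne_top _ _
  have hG1 : 0 < Real.Gamma (q / 2 + (m + 1 : ℕ)) := Real.Gamma_pos_of_pos (by positivity)
  have hG2 : 0 < Real.Gamma ((m + 1 : ℕ) : ℝ) := Real.Gamma_pos_of_pos (by positivity)
  have hG3 : 0 < Real.Gamma (q / 2 + 1) := Real.Gamma_pos_of_pos (by positivity)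
  rw [uniformSphere, lintegral_smul_measure, smul_eq_mul]
  show S⁻¹ * ∫⁻ u, ENNReal.ofReal (‖inner ℂ w (u : E)‖ ^ q) ∂μ.toSphere = _
  set T := ∫⁻ u, ENNReal.ofReal (‖inner ℂ w (u : E)‖ ^ q) ∂μ.toSphere
  have hc0 : ENNReal.ofReal (Real.Gamma (q / 2 + (m + 1 : ℕ)) / 2) ≠ 0 := by
    simpa using hG1
  refine (ENNReal.mul_left_inj hc0 ENNReal.ofReal_ne_top).mp ?_
  rw [mul_assoc, h, mul_left_comm, ← mul_assoc S⁻¹, ENNReal.inv_mul_cancel hS0 hSt, one_mul,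
    ← ENNReal.ofReal_mul hG3.le, ← ENNReal.ofReal_mul (by positivity)]
  congr 1
  field_simp

theorem lintegral_norm_inner_rpow_of_pos {N : ℕ} (hN : Module.finrank ℂ E = N) (hN0 : 0 < N)
    {w : E} {s : ℝ} (hs : 0 < s) (hw : ‖w‖ = s) {q : ℝ} (hq : 0 ≤ q) :
    ∫⁻ u, ENNReal.ofReal (‖inner ℂ w (u : E)‖ ^ q) ∂uniformSphere E = ENNReal.ofReal
      (s ^ q * (Real.Gamma (q / 2 + 1) * Real.Gamma N / Real.Gamma (q / 2 + N))) := by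
  have hw' : ‖((s⁻¹ : ℝ) : ℂ) • w‖ = 1 := by
    rw [norm_smul, hw, Complex.norm_real, Real.norm_of_nonneg (by positivity),
      inv_mul_cancel₀ hs.ne']
  have hu : ∀ u : E, ‖inner ℂ w u‖ ^ q = s ^ q * ‖inner ℂ (((s⁻¹ : ℝ) : ℂ) • w) u‖ ^ q := by
    intro u
    rw [← Real.mul_rpow hs.le (norm_nonneg _), inner_smul_left, norm_mul,
      RCLike.norm_conj, Complex.norm_real, Real.norm_of_nonneg (by positivity),
      mul_inv_cancel_left₀ hs.ne']
  simp_rw [hu, ENNReal.ofReal_mul (Real.rpow_nonneg hs.le q)]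
  rw [lintegral_const_mul' _ _ (by simp), lintegral_norm_inner_rpow hN hN0 hw' hq]

end Complex

end

end SphHarm

/-! ### Medians, random bases and the main theorem -/

namespace SphHarm

noncomputable section

theorem eLpNorm_ofReal_eq {Ω : Type} [MeasurableSpace Ω] (P : Measure Ω) (f : Ω → ℝ) {q : ℝ}
    (hq : 0 < q) : eLpNorm f (ENNReal.ofReal q) P =
      (∫⁻ ω, ENNReal.ofReal (|f ω| ^ q) ∂P) ^ (1 / q) := by
  rw [eLpNorm_eq_lintegral_rpow_enorm_toReal (by simpa using hq) (by simp),
    ENNReal.toReal_ofReal hq.le]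
  congr 1
  refine lintegral_congr fun ω => ?_
  rw [← ENNReal.ofReal_rpow_of_nonneg (abs_nonneg _) hq.le, ← Real.norm_eq_abs, ofReal_norm]

/-- The `q`-th mean of a nonnegative random variable is close to any number around which its
`q`-th central moment is small. -/
theorem abs_sub_le_of_moments {Ω : Type} [MeasurableSpace Ω] (P : Measure Ω)
    [IsProbabilityMeasure P] {F : Ω → ℝ} (hF : Measurable F) (hF0 : 0 ≤ F) {A M D q : ℝ}
    (hA : 0 ≤ A) (hM : 0 ≤ M) (hD : 0 ≤ D) (hq : 1 ≤ q)
    (h1 : ∫⁻ ω, ENNReal.ofReal (F ω ^ q) ∂P = ENNReal.ofReal (A ^ q))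
    (h2 : ∫⁻ ω, ENNReal.ofReal (|F ω - M| ^ q) ∂P ≤ ENNReal.ofReal (D ^ q)) : |A - M| ≤ D := by
  have hq0 : 0 < q := by linarith
  have hroot : ∀ x : ℝ, 0 ≤ x → ENNReal.ofReal (x ^ q) ^ (1 / q) = ENNReal.ofReal x := by
    intro x hx
    rw [← ENNReal.ofReal_rpow_of_nonneg hx hq0.le, ← ENNReal.rpow_mul, mul_one_div_cancel hq0.ne',
      ENNReal.rpow_one]
  have e1 : eLpNorm F (ENNReal.ofReal q) P = ENNReal.ofReal A := by
    rw [eLpNorm_ofReal_eq P F hq0, ← hroot A hA, ← h1]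
    congr 1
    exact lintegral_congr fun ω => by rw [abs_of_nonneg (hF0 ω)]
  have e2 : eLpNorm (fun ω => F ω - M) (ENNReal.ofReal q) P ≤ ENNReal.ofReal D := by
    rw [eLpNorm_ofReal_eq P _ hq0, ← hroot D hD]
    exact ENNReal.rpow_le_rpow h2 (by positivity)
  have e3 : eLpNorm (fun _ : Ω => M) (ENNReal.ofReal q) P = ENNReal.ofReal M := by
    rw [eLpNorm_const _ (by simpa using hq0) (IsProbabilityMeasure.ne_zero P), measure_univ,
      ENNReal.one_rpow, mul_one, ← ofReal_norm, Real.norm_of_nonneg hM]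
  have hp : 1 ≤ ENNReal.ofReal q := by simpa using hq
  have hm : AEStronglyMeasurable F P := hF.aestronglyMeasurable
  -- The triangle inequality in `L^q(P)`, in both directions, between `F` and the constant function
  -- `M`.
  have t1 : ENNReal.ofReal A ≤ ENNReal.ofReal D + ENNReal.ofReal M := by
    have := eLpNorm_add_le (f := fun ω => F ω - M) (g := fun _ => M) (μ := P)
      (hm.sub aestronglyMeasurable_const) aestronglyMeasurable_const hp
    rw [show (fun ω => F ω - M) + (fun _ => M) = F by funext ω; simp, e1, e3] at this
    exact this.trans (by gcongr)
  have t2 : ENNReal.ofReal M ≤ ENNReal.ofReal A + ENNReal.ofReal D := by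
    have := eLpNorm_sub_le (f := F) (g := fun ω => F ω - M) (μ := P) hm
      (hm.sub aestronglyMeasurable_const) hp
    rw [show F - (fun ω => F ω - M) = fun _ => M by funext ω; simp, e1, e3] at this
    exact this.trans (by gcongr)
  rw [← ENNReal.ofReal_add hD hM, ENNReal.ofReal_le_ofReal_iff (by positivity)] at t1
  rw [← ENNReal.ofReal_add hA hD, ENNReal.ofReal_le_ofReal_iff (by positivity)] at t2
  rw [abs_le]
  constructor <;> linarith

/-! ### Medians and the Gamma approximation -/

section Median

variable {𝕂 : Type} [RCLike 𝕂] {d k : ℕ}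

theorem measurable_lqNorm_sphere {q : ℝ} (hq : 2 ≤ q) :
    Measurable fun u : Metric.sphere (0 : harmonics 𝕂 d k) 1 => lqNorm q u.1 :=
  ((continuous_lqNorm hq).comp continuous_subtype_val).measurable

theorem exists_isLqMedian (𝕂 : Type) [RCLike 𝕂] (hd : 2 ≤ d) {q : ℝ} (hq : 2 ≤ q) (k : ℕ) :
    ∃ m, IsLqMedian 𝕂 d k q m := by
  have := nontrivial_harmonics (𝕂 := 𝕂) hd k
  exact exists_isMedian _ (measurable_lqNorm_sphere hq)

theorem IsLqMedian.nonneg {q M : ℝ} (hM : IsLqMedian 𝕂 d k q M) : 0 ≤ M := by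
  obtain ⟨u, hu⟩ := nonempty_of_measure_ne_zero
    (lt_of_lt_of_le (by norm_num) hM.2 : 0 < uniformSphere (harmonics 𝕂 d k) _).ne'
  exact (lqNorm_nonneg q u.1).trans hu

theorem gammaApprox_nonneg (d : ℕ) {q : ℝ} (hq : 0 < q) {N : ℕ} (hN : 0 < N) :
    0 ≤ gammaApprox d q N := by
  have hV := volSph_pos d
  have hN' : (0 : ℝ) < N := by exact_mod_cast hN
  have h1 : 0 < Real.Gamma (q / 2) := Real.Gamma_pos_of_pos (by positivity)
  have h2 : 0 < Real.Gamma N := Real.Gamma_pos_of_pos hN'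
  have h3 : 0 < Real.Gamma (q / 2 + N) := Real.Gamma_pos_of_pos (by positivity)
  unfold gammaApprox
  positivity

/-- Uses `q * Γ(q/2) / 2 = Γ(q/2 + 1)` to bring the formula into the shape of a coordinate moment
scaled by the evaluation norm and integrated over `S^d`. -/
theorem gammaApprox_rpow (d : ℕ) {q : ℝ} (hq : 0 < q) {N : ℕ} (hN : 0 < N) :
    gammaApprox d q N ^ q = Real.sqrt (N / volSph d) ^ q *
      (Real.Gamma (q / 2 + 1) * Real.Gamma N / Real.Gamma (q / 2 + N)) * volSph d := by
  have hV := volSph_pos d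
  have hN' : (0 : ℝ) < N := by exact_mod_cast hN
  have h1 : 0 < Real.Gamma (q / 2) := Real.Gamma_pos_of_pos (by positivity)
  have h2 : 0 < Real.Gamma N := Real.Gamma_pos_of_pos hN'
  have h3 : 0 < Real.Gamma (q / 2 + N) := Real.Gamma_pos_of_pos (by positivity)
  have e1 : ((N : ℝ) ^ (1 / 2 : ℝ)) ^ q = (N : ℝ) ^ (q / 2) := by
    rw [← Real.rpow_mul hN'.le]; congr 1; ring
  have e2 : (volSph d ^ (1 / 2 - 1 / q)) ^ q = volSph d ^ (q / 2) / volSph d := by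
    rw [← Real.rpow_mul hV.le, show (1 / 2 - 1 / q) * q = q / 2 - 1 by field_simp,
      Real.rpow_sub_one hV.ne']
  have e3 : Real.sqrt (N / volSph d) ^ q = (N : ℝ) ^ (q / 2) / volSph d ^ (q / 2) := by
    rw [Real.sqrt_eq_rpow, ← Real.rpow_mul (by positivity), ← Real.div_rpow hN'.le hV.le]
    congr 1; ring
  rw [gammaApprox, Real.mul_rpow (by positivity) (by positivity),
    Real.div_rpow (by positivity) (by positivity), e1, e2, e3, ← Real.rpow_mul (by positivity),
    one_div_mul_cancel hq.ne', Real.rpow_one, Real.Gamma_add_one (by positivity)]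
  field_simp

/-- After Tonelli, `u(x)` is an inner product with a vector whose length does not depend on `x`, so
the inner integral is the same coordinate moment for every `x`. -/
theorem lintegral_lqNorm_rpow_complex (hd : 2 ≤ d) {q : ℝ} (hq : 0 < q) :
    ∫⁻ u, ENNReal.ofReal (lqNorm q u.1 ^ q) ∂uniformSphere (harmonics ℂ d k) =
      ENNReal.ofReal (gammaApprox d q (dimH ℂ d k) ^ q) := by
  have hN : 0 < dimH ℂ d k := (Nat.zero_le k).trans_lt (lt_dimH ℂ k hd)
  have hN' : (0 : ℝ) < dimH ℂ d k := by exact_mod_cast hN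
  have hV := volSph_pos d
  set s := Real.sqrt (dimH ℂ d k / volSph d) with hs
  have hs0 : 0 < s := Real.sqrt_pos.mpr (by positivity)
  rw [lintegral_lqNorm_rpow hd hq, gammaApprox_rpow d hq hN, ENNReal.ofReal_mul' hV.le,
    ofReal_volSph, ← lintegral_const]
  refine lintegral_congr fun x => ?_
  have hx : ‖reprVec ℂ k x‖ = s := by rw [norm_reprVec, norm_evalCLM]
  simp_rw [← inner_reprVec]
  exact lintegral_norm_inner_rpow_of_pos rfl hN hs0 hx hq.le

/-- In the complex case the median is close to an explicit ratio of Gamma functions. -/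
theorem exists_abs_gammaApprox_sub_median_le (hd : 2 ≤ d) :
    ∃ C : ℝ, ∀ q : ℝ, 2 ≤ q → ∀ (k : ℕ) (m : ℝ), IsLqMedian ℂ d k q m →
      |gammaApprox d q (dimH ℂ d k) - m| ≤
        C / (dimH ℂ d k : ℝ) ^ (1 / q) * Real.sqrt q := by
  have hV := volSph_pos d
  -- The moment bound with prefactor `16` and rate `concRate`; the square root of `N^(2/q)` in the
  -- rate supplies the denominator `N^(1/q)`.
  refine ⟨2 * 16 / Real.sqrt (min 1 (volSph d) / 64), fun q hq k m hm => ?_⟩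
  have hN : 0 < dimH ℂ d k := (Nat.zero_le k).trans_lt (lt_dimH ℂ k hd)
  have hN' : (0 : ℝ) < dimH ℂ d k := by exact_mod_cast hN
  have hq0 : 0 < q := by linarith
  have := nontrivial_harmonics (𝕂 := ℂ) hd k
  have ha := concRate_pos (d := d) hN q
  have key := abs_sub_le_of_moments (uniformSphere (harmonics ℂ d k))
    (measurable_lqNorm_sphere hq) (fun u => lqNorm_nonneg q u.1) (gammaApprox_nonneg d hq0 hN)
    hm.nonneg (D := 2 * 16 * Real.sqrt q / Real.sqrt (concRate d q (dimH ℂ d k)))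
    (by positivity) (by linarith) (lintegral_lqNorm_rpow_complex hd hq0)
    (lintegral_rpow_le_of_tail _ ((measurable_lqNorm_sphere hq).sub_const m).abs
      (fun u => abs_nonneg _) (by norm_num) ha (by linarith)
      fun t ht => uniformSphere_lqNorm_sub_median_le hd hq hm ht)
  refine key.trans (le_of_eq ?_)
  rw [concRate, Real.sqrt_mul (by positivity), Real.sqrt_eq_rpow ((dimH ℂ d k : ℝ) ^ (2 / q)),
    ← Real.rpow_mul hN'.le, show 2 / q * (1 / 2) = 1 / q by field_simp]
  field_simp

end Median

theorem rpow_le_mul_exp {s c y : ℝ} (hs : 0 < s) (hc : 0 < c) (hy : 0 ≤ y) :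
    y ^ s ≤ (s / c) ^ s * Real.exp (c * y) := by
  have h : (c * y / s) ^ s ≤ Real.exp (c * y) := by
    calc (c * y / s) ^ s ≤ Real.exp (c * y / s) ^ s := by
          gcongr
          have := Real.add_one_le_exp (c * y / s)
          linarith
      _ = _ := by rw [← Real.exp_mul]; congr 1; field_simp
  calc y ^ s = (s / c * (c * y / s)) ^ s := by congr 1; field_simp
    _ = (s / c) ^ s * (c * y / s) ^ s := Real.mul_rpow (by positivity) (by positivity)
    _ ≤ _ := by gcongr

/-! ### The union bound over all degrees -/

section Union

variable (d : ℕ)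

/-- The exponential rate for random bases. -/
def basisRate : ℝ := min 1 (volSph d) / 128

theorem basisRate_pos : 0 < basisRate d := by
  have := volSph_pos d
  unfold basisRate
  positivity

/-- The `k`-th term of the series dominating the union bound. -/
def unionTerm (q : ℝ) (k : ℕ) : ℝ :=
  16 * (3 * q / 2 / basisRate d) ^ (3 * q / 2) * (1 / ((k : ℝ) + 1) ^ 2)

/-- The constant in the concentration inequality for random bases. -/
def unionConst (q : ℝ) : ℝ := Real.exp (basisRate d) + ∑' k, unionTerm d q k

variable {d}

theorem unionTerm_nonneg {q : ℝ} (hq : 0 < q) (k : ℕ) : 0 ≤ unionTerm d q k := by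
  have := basisRate_pos d
  unfold unionTerm
  positivity

theorem summable_unionTerm (q : ℝ) : Summable (unionTerm d q) := by
  unfold unionTerm
  refine Summable.mul_left _ ?_
  have := (summable_nat_add_iff 1).mpr (Real.summable_one_div_nat_pow.mpr one_lt_two)
  simpa using this

theorem unionConst_pos {q : ℝ} (hq : 0 < q) : 0 < unionConst d q :=
  add_pos_of_pos_of_nonneg (Real.exp_pos _) (tsum_nonneg (unionTerm_nonneg hq))

/-- With `y = N^(2/q)` the exponent is `2 c y r²`, at least `c y + c r²` since `y, r² ≥ 1`; this is
why `basisRate` has `128` instead of `64`. The part `exp(-c y)` absorbs `N³ = y^(3q/2)`, leaving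
`N⁻² ≤ (k + 1)⁻²` after the factor `N` counting the basis elements is paid. -/
theorem mul_exp_concRate_le {q : ℝ} (hq : 2 ≤ q) {N k : ℕ} (hk : k < N) {r : ℝ} (hr : 1 ≤ r) :
    N * (16 * Real.exp (-(concRate d q N * r ^ 2))) ≤
      unionTerm d q k * Real.exp (-basisRate d * r ^ 2) := by
  have hq0 : 0 < q := by linarith
  have hN : 0 < N := (Nat.zero_le k).trans_lt hk
  have hN1 : (1 : ℝ) ≤ N := by exact_mod_cast hN
  have hN' : (0 : ℝ) < N := by linarith
  have hkN : (k : ℝ) + 1 ≤ N := by exact_mod_cast hk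
  have hc := basisRate_pos d
  set c := basisRate d with hcdef
  set y := (N : ℝ) ^ (2 / q) with hy
  have hy1 : 1 ≤ y := Real.one_le_rpow hN1 (by positivity)
  have hr2 : 1 ≤ r ^ 2 := one_le_pow₀ hr
  have h1 : concRate d q N * r ^ 2 = c * (2 * (y * r ^ 2)) := by
    rw [concRate, hcdef, basisRate]; ring
  have h2 : c * y + c * r ^ 2 ≤ concRate d q N * r ^ 2 := by
    rw [h1, ← mul_add]
    gcongr
    nlinarith
  have h3 : (N : ℝ) ^ 3 = y ^ (3 * q / 2) := by
    rw [hy, ← Real.rpow_mul hN'.le, show 2 / q * (3 * q / 2) = (3 : ℕ) by field_simp; norm_num,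
      Real.rpow_natCast]
  set Q := (3 * q / 2 / c) ^ (3 * q / 2) with hQ
  have h4 : (N : ℝ) ^ 3 ≤ Q * Real.exp (c * y) := by
    rw [h3]
    exact rpow_le_mul_exp (by positivity) hc (by positivity)
  have hQ0 : 0 ≤ Q := by positivity
  have h5 : N * Real.exp (-(c * y)) ≤ Q * (1 / ((k : ℝ) + 1) ^ 2) := by
    have h6 : N * Real.exp (-(c * y)) ≤ Q * (1 / (N : ℝ) ^ 2) := by
      rw [mul_one_div, le_div_iff₀ (by positivity), Real.exp_neg, ← div_eq_mul_inv,
        div_mul_eq_mul_div, div_le_iff₀ (Real.exp_pos _)]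
      calc (N : ℝ) * N ^ 2 = N ^ 3 := by ring
        _ ≤ _ := h4
    refine h6.trans ?_
    gcongr
  calc N * (16 * Real.exp (-(concRate d q N * r ^ 2)))
      ≤ N * (16 * Real.exp (-(c * y + c * r ^ 2))) := by gcongr
    _ = 16 * (N * Real.exp (-(c * y))) * Real.exp (-c * r ^ 2) := by
        rw [neg_add, Real.exp_add, neg_mul]; ring
    _ ≤ 16 * (Q * (1 / ((k : ℝ) + 1) ^ 2)) * Real.exp (-c * r ^ 2) := by gcongr
    _ = _ := by rw [unionTerm, ← hcdef, ← hQ]; ring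

variable {𝕂 : Type} [RCLike 𝕂]

instance : IsProbabilityMeasure (basisLaw 𝕂 d) := by unfold basisLaw; infer_instance

/-- Concentration of the `L^q` norms of all elements of a random basis. -/
theorem basisLaw_exists_le (hd : 2 ≤ d) {q : ℝ} (hq : 2 ≤ q) (e : RefBasis 𝕂 d) {M : ℕ → ℝ}
    (hM : ∀ k, IsLqMedian 𝕂 d k q (M k)) {r : ℝ} (hr : 0 ≤ r) :
    basisLaw 𝕂 d {B | ∃ k l, r < |lqNorm q (basisElt e B k l) - M k|} ≤
      ENNReal.ofReal (unionConst d q * Real.exp (-basisRate d * r ^ 2)) := by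
  have hq0 : 0 < q := by linarith
  have hc := basisRate_pos d
  have hT0 : 0 ≤ ∑' k, unionTerm d q k := tsum_nonneg (unionTerm_nonneg hq0)
  -- For `r ≤ 1` the bound exceeds `1` thanks to the term `exp (basisRate d)` in `unionConst`; the
  -- series estimate needs `r ≥ 1`.
  rcases le_total r 1 with h1 | h1
  · refine prob_le_one.trans ?_
    rw [← ENNReal.ofReal_one]
    refine ENNReal.ofReal_le_ofReal ?_
    calc (1 : ℝ) = Real.exp (basisRate d) * Real.exp (-basisRate d * 1) := by
          rw [← Real.exp_add]; simp
      _ ≤ unionConst d q * Real.exp (-basisRate d * r ^ 2) := by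
          have : r ^ 2 ≤ 1 := pow_le_one₀ hr h1
          refine mul_le_mul (le_add_of_nonneg_right hT0) (Real.exp_le_exp.mpr ?_)
            (Real.exp_nonneg _) (unionConst_pos hq0).le
          nlinarith
  · have hU : {B | ∃ k l, r < |lqNorm q (basisElt e B k l) - M k|} =
        ⋃ k, ⋃ l, {B | r < |lqNorm q (basisElt e B k l) - M k|} := by
      ext B; simp
    rw [hU]
    refine (measure_iUnion_le _).trans ?_
    calc ∑' k, basisLaw 𝕂 d (⋃ l, {B | r < |lqNorm q (basisElt e B k l) - M k|})
        ≤ ∑' k, ENNReal.ofReal (unionTerm d q k * Real.exp (-basisRate d * r ^ 2)) := by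
          refine ENNReal.tsum_le_tsum fun k => ?_
          refine (measure_iUnion_fintype_le _ _).trans ?_
          have hl : ∀ l, basisLaw 𝕂 d {B | r < |lqNorm q (basisElt e B k l) - M k|} ≤
              ENNReal.ofReal (16 * Real.exp (-(concRate d q (dimH 𝕂 d k) * r ^ 2))) := by
            intro l
            rw [basisLaw_basisElt hd e k l (p := fun u => r < |lqNorm q u - M k|)
              (measurableSet_lt measurable_const
                ((continuous_lqNorm hq).measurable.sub_const _).abs)]
            exact uniformSphere_lqNorm_sub_median_le hd hq (hM k) hr
          refine (Finset.sum_le_sum fun l _ => hl l).trans ?_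
          rw [Finset.sum_const, Finset.card_univ, Fintype.card_fin, nsmul_eq_mul,
            ← ENNReal.ofReal_natCast, ← ENNReal.ofReal_mul (Nat.cast_nonneg _)]
          exact ENNReal.ofReal_le_ofReal (mul_exp_concRate_le hq (lt_dimH 𝕂 k hd) h1)
      _ = ENNReal.ofReal ((∑' k, unionTerm d q k) * Real.exp (-basisRate d * r ^ 2)) := by
          rw [← ENNReal.ofReal_tsum_of_nonneg
            (fun k => mul_nonneg (unionTerm_nonneg hq0 k) (Real.exp_nonneg _))
            ((summable_unionTerm q).mul_right _), tsum_mul_right]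
      _ ≤ _ := by
          refine ENNReal.ofReal_le_ofReal ?_
          gcongr
          exact le_add_of_nonneg_left (Real.exp_nonneg _)

/-- With medians at most `K₀`, an unbounded family of norms must deviate from them by more than
every `r`, and the probability of that tends to `0`. -/
theorem ae_exists_lqNorm_le (hd : 2 ≤ d) {q : ℝ} (hq : 2 ≤ q) (e : RefBasis 𝕂 d) :
    ∀ᵐ B ∂basisLaw 𝕂 d, ∃ K : ℝ, ∀ k l, lqNorm q (basisElt e B k l) ≤ K := by
  choose M hM using fun k => exists_isLqMedian 𝕂 hd hq k
  obtain ⟨K₀, hK₀⟩ := exists_median_le (𝕂 := 𝕂) hd hq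
  rw [ae_iff]
  have hle : ∀ r : ℕ, basisLaw 𝕂 d {B | ¬∃ K : ℝ, ∀ k l, lqNorm q (basisElt e B k l) ≤ K} ≤
      ENNReal.ofReal (unionConst d q * Real.exp (-basisRate d * (r : ℝ) ^ 2)) := by
    intro r
    refine (measure_mono fun B hB => ?_).trans (basisLaw_exists_le hd hq e hM (Nat.cast_nonneg r))
    by_contra hcon
    refine hB ⟨K₀ + r, fun k l => ?_⟩
    have h1 : |lqNorm q (basisElt e B k l) - M k| ≤ r := by
      by_contra h
      exact hcon ⟨k, l, not_le.mp h⟩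
    have h2 := hK₀ k (M k) (hM k)
    have h3 := (abs_le.mp h1).2
    linarith
  refine le_antisymm (ge_of_tendsto' (x := Filter.atTop) ?_ hle) zero_le
  rw [← ENNReal.ofReal_zero, ← mul_zero (unionConst d q)]
  refine ENNReal.tendsto_ofReal (Filter.Tendsto.const_mul _ ?_)
  refine Real.tendsto_exp_atBot.comp ?_
  refine Filter.Tendsto.const_mul_atTop_of_neg (by linarith [basisRate_pos d]) ?_
  exact (Filter.tendsto_pow_atTop two_ne_zero).comp tendsto_natCast_atTop_atTop

/-- One null set must serve uncountably many `q`: it suffices to treat the exponents `n + 2`, since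
on a sphere of finite measure a larger exponent controls a smaller one. This also covers `1 ≤ q <
2`. -/
theorem ae_forall_exists_lqNorm_le (hd : 2 ≤ d) (e : RefBasis 𝕂 d) :
    ∀ᵐ B ∂basisLaw 𝕂 d, ∀ q : ℝ, 1 ≤ q →
      ∃ K : ℝ, ∀ k l, lqNorm q (basisElt e B k l) ≤ K := by
  have h : ∀ᵐ B ∂basisLaw 𝕂 d, ∀ n : ℕ,
      ∃ K : ℝ, ∀ k l, lqNorm ((n : ℝ) + 2) (basisElt e B k l) ≤ K :=
    ae_all_iff.mpr fun n => ae_exists_lqNorm_le hd (by have := n.cast_nonneg (α := ℝ); linarith) e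
  filter_upwards [h] with B hB q hq
  obtain ⟨n, hn⟩ := exists_nat_ge q
  obtain ⟨K, hK⟩ := hB n
  refine ⟨K * volSph d ^ (1 / q - 1 / ((n : ℝ) + 2)), fun k l => ?_⟩
  refine (lqNorm_mono_exponent (by linarith) (by linarith : q ≤ (n : ℝ) + 2) _).trans ?_
  have := Real.rpow_nonneg (volSph_pos d).le (1 / q - 1 / ((n : ℝ) + 2))
  gcongr
  exact hK k l

end Union

end

end SphHarm

theorem mainTheorem3 (d : ℕ) (hd : 2 ≤ d) :
    -- the medians exist
    (∀ q : ℝ, 2 ≤ q → ∀ k : ℕ,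
      (∃ m, SphHarm.IsLqMedian ℂ d k q m) ∧ (∃ m, SphHarm.IsLqMedian ℝ d k q m)) ∧
    -- concentration, complex and real case
    (∃ c : ℝ, 0 < c ∧ ∀ q : ℝ, 2 ≤ q → ∃ Cq : ℝ, 0 < Cq ∧
      (∀ (e : SphHarm.RefBasis ℂ d) (M : ℕ → ℝ), (∀ k, SphHarm.IsLqMedian ℂ d k q (M k)) →
        ∀ r : ℝ, 0 ≤ r →
          SphHarm.basisLaw ℂ d
              {B | ∃ k l, r < |SphHarm.lqNorm q (SphHarm.basisElt e B k l) - M k|} ≤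
            ENNReal.ofReal (Cq * Real.exp (-c * r ^ 2))) ∧
      (∀ (e : SphHarm.RefBasis ℝ d) (M : ℕ → ℝ), (∀ k, SphHarm.IsLqMedian ℝ d k q (M k)) →
        ∀ r : ℝ, 0 ≤ r →
          SphHarm.basisLaw ℝ d
              {B | ∃ k l, r < |SphHarm.lqNorm q (SphHarm.basisElt e B k l) - M k|} ≤
            ENNReal.ofReal (Cq * Real.exp (-c * r ^ 2)))) ∧
    -- approximation of the median, complex case
    (∃ C : ℝ, ∀ q : ℝ, 2 ≤ q → ∀ (k : ℕ) (m : ℝ), SphHarm.IsLqMedian ℂ d k q m →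
      |SphHarm.gammaApprox d q (SphHarm.dimH ℂ d k) - m| ≤
        C / (SphHarm.dimH ℂ d k : ℝ) ^ (1 / q) * Real.sqrt q) ∧
    -- almost sure uniform boundedness, complex and real case
    (∀ e : SphHarm.RefBasis ℂ d, ∀ᵐ B ∂(SphHarm.basisLaw ℂ d), ∀ q : ℝ, 1 ≤ q →
      ∃ K : ℝ, ∀ k l, SphHarm.lqNorm q (SphHarm.basisElt e B k l) ≤ K) ∧
    (∀ e : SphHarm.RefBasis ℝ d, ∀ᵐ B ∂(SphHarm.basisLaw ℝ d), ∀ q : ℝ, 1 ≤ q →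
      ∃ K : ℝ, ∀ k l, SphHarm.lqNorm q (SphHarm.basisElt e B k l) ≤ K) := by
  refine ⟨fun q hq k => ⟨SphHarm.exists_isLqMedian ℂ hd hq k, SphHarm.exists_isLqMedian ℝ hd hq k⟩,
    -- Both constants are independent of `𝕂`, because of `N_k` the union bound uses only `N_k > k`.
    ⟨SphHarm.basisRate d, SphHarm.basisRate_pos d, fun q hq => ⟨SphHarm.unionConst d q,
      SphHarm.unionConst_pos (by linarith), fun e M hM r hr => ?_, fun e M hM r hr => ?_⟩⟩,
    SphHarm.exists_abs_gammaApprox_sub_median_le hd, SphHarm.ae_forall_exists_lqNorm_le hd,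
    SphHarm.ae_forall_exists_lqNorm_le hd⟩
  · exact SphHarm.basisLaw_exists_le hd hq e hM hr
  · exact SphHarm.basisLaw_exists_le hd hq e hM hr
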